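/- Let $n\ge 2$ and let $H^2(\mathbb D^n)$ be the Hardy space over the polydisc (the closure of the polynomials $\mathbb C[z_1,\dots,z_n]$ in $L^2(\mathbb T^n)$) with the multiplication operators $M_{z_1},\dots,M_{z_n}$ by the coordinate functions. Let $\mathcal Q$ be a quotient module of $H^2(\mathbb D^n)$, that is, a closed subspace with $M_{z_i}^*\mathcal Q\subseteq\mathcal Q$ for all $i$, and let $C_{z_i}=P_{\mathcal Q}M_{z_i}|_{\mathcal Q}$ be its module operators. Assume that $\mathcal Q$ is doubly commuting, i.e. $C_{z_i}C_{z_j}^*=C_{z_j}^*C_{z_i}$ for all $1\le i<j\le n$, and non-trivial, i.e. $\{0\}\ne\mathcal Q\ne H^2(\mathbb D^n)$. Then for some $1\le i\le n$ the operator $C_{z_i}$ belongs to the Sz.-Nagy–Foias class $C_0$: it is a completely non-unitary contraction, and there is a nonzero function $\Theta\in H^\infty(\mathbb D)$ with $\Theta(C_{z_i})=0$. Here, for a completely non-unitary contraction $T$ and $\Theta(z)=\sum_k a_kz^k\in H^\infty(\mathbb D)$, $\Theta(T)$ is the strong limit of $\sum_k a_kr^kT^k$ as $r\uparrow 1$.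 Moreover, if $\Theta_1,\dots,\Theta_n$ represent $\mathcal Q$, that is, each $\Theta_i$ is an inner function on $\mathbb D$ or the zero function and $\mathcal Q=\mathcal Q_{\Theta_1}\otimes\cdots\otimes\mathcal Q_{\Theta_n}$ with $\mathcal Q_{\Theta_i}=H^2(\mathbb D)\ominus\Theta_iH^2(\mathbb D)$, then for some $i$ the function $\Theta_i$ is nonzero, $\Theta_i(C_{z_i})=0$ and $C_{z_i}\in C_0$. -/

import Mathlib

open MeasureTheory Filter Topology
open scoped ENNReal

noncomputable section

namespace HardyPolydisc

/-! ### The Hardy module over the polydisc -/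

/-- The normalized Lebesgue (Haar probability) measure on the torus `𝕋ⁿ`, where the circle is
parametrized by `ℝ / ℤ` through `t ↦ exp (2πit)`. -/
abbrev torusMeasure (n : ℕ) : Measure (UnitAddTorus (Fin n)) :=
  Measure.pi fun _ => (AddCircle.haarAddCircle : Measure UnitAddCircle)

/-- `L²(𝕋ⁿ)`. -/
abbrev L2Torus (n : ℕ) : Type := Lp ℂ 2 (torusMeasure n)

/-- The monomial `z₁ ^ k₁ ⋯ zₙ ^ kₙ` as an element of `L²(𝕋ⁿ)`. -/
def monomialL2 {n : ℕ} (k : Fin n → ℕ) : L2Torus n :=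
  ContinuousMap.toLp (E := ℂ) 2 (torusMeasure n) ℂ (UnitAddTorus.mFourier fun i => (k i : ℤ))

/-- The closure of the polynomials in `L²(𝕋ⁿ)`. -/
def hardySubspace (n : ℕ) : Submodule ℂ (L2Torus n) :=
  (Submodule.span ℂ (Set.range (monomialL2 (n := n)))).topologicalClosure

/-- Multiplication by the coordinate function `z_i` on `L²(𝕋ⁿ)`. -/
def mulCoordL2 {n : ℕ} (i : Fin n) : L2Torus n →L[ℂ] L2Torus n :=
  (ContinuousLinearMap.mul ℂ ℂ).holderL (torusMeasure n) ∞ 2 2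
    (ContinuousMap.toLp (E := ℂ) ∞ (torusMeasure n) ℂ (UnitAddTorus.mFourier (Pi.single i 1)))

theorem mulCoordL2_monomialL2 {n : ℕ} (i : Fin n) (k : Fin n → ℕ) :
    mulCoordL2 i (monomialL2 k) = monomialL2 (k + Pi.single i 1) := by
  have hz : (UnitAddTorus.mFourier fun j => (((k + Pi.single i 1 : Fin n → ℕ) j : ℕ) : ℤ)) =
      UnitAddTorus.mFourier (Pi.single i 1) * UnitAddTorus.mFourier fun j => (k j : ℤ) := by
    ext x
    rw [ContinuousMap.mul_apply, ← UnitAddTorus.mFourier_add]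
    congr 2
    funext j
    by_cases hj : j = i
    · subst hj; simp [add_comm]
    · simp [hj]
  apply Lp.ext
  simp only [mulCoordL2, monomialL2, ContinuousLinearMap.holderL_apply_apply]
  filter_upwards [ContinuousLinearMap.coeFn_holder (r := 2) (ContinuousLinearMap.mul ℂ ℂ)
      (ContinuousMap.toLp (E := ℂ) ∞ (torusMeasure n) ℂ (UnitAddTorus.mFourier (Pi.single i 1)))
      (ContinuousMap.toLp (E := ℂ) 2 (torusMeasure n) ℂ
        (UnitAddTorus.mFourier fun j => (k j : ℤ))),
    ContinuousMap.coeFn_toLp (E := ℂ) (p := ∞) (𝕜 := ℂ) (torusMeasure n)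
      (UnitAddTorus.mFourier (Pi.single i 1)),
    ContinuousMap.coeFn_toLp (E := ℂ) (p := 2) (𝕜 := ℂ) (torusMeasure n)
      (UnitAddTorus.mFourier fun j => (k j : ℤ)),
    ContinuousMap.coeFn_toLp (E := ℂ) (p := 2) (𝕜 := ℂ) (torusMeasure n)
      (UnitAddTorus.mFourier fun j => (((k + Pi.single i 1 : Fin n → ℕ) j : ℕ) : ℤ))] with x h1 h2 h3 h4
  rw [h1, h2, h3, h4, hz]
  rfl

theorem mulCoordL2_mem {n : ℕ} (i : Fin n) {f : L2Torus n} (hf : f ∈ hardySubspace n) :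
    mulCoordL2 i f ∈ hardySubspace n := by
  refine map_mem_closure (mulCoordL2 i).continuous hf fun g hg => ?_
  have hle : Submodule.span ℂ (Set.range (monomialL2 (n := n))) ≤
      (Submodule.span ℂ (Set.range (monomialL2 (n := n)))).comap
        (mulCoordL2 i : L2Torus n →ₗ[ℂ] L2Torus n) := by
    rw [Submodule.span_le]
    rintro _ ⟨k, rfl⟩
    exact Submodule.subset_span ⟨k + Pi.single i 1, (mulCoordL2_monomialL2 i k).symm⟩
  exact hle hg

/-- The Hardy space `H²(𝔻ⁿ)`: the closure of the polynomials in `L²(𝕋ⁿ)`, as a Hilbert space. -/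
def HardySpace (n : ℕ) : Type := hardySubspace n

instance (n : ℕ) : NormedAddCommGroup (HardySpace n) :=
  inferInstanceAs (NormedAddCommGroup (hardySubspace n))

instance (n : ℕ) : InnerProductSpace ℂ (HardySpace n) :=
  inferInstanceAs (InnerProductSpace ℂ (hardySubspace n))

instance (n : ℕ) : CompleteSpace (HardySpace n) :=
  (Submodule.isClosed_topologicalClosure _).completeSpace_coe

/-- The inclusion of `H²(𝔻ⁿ)` in `L²(𝕋ⁿ)`. -/
def HardySpace.incl (n : ℕ) : HardySpace n →L[ℂ] L2Torus n := (hardySubspace n).subtypeL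

/-- The module multiplication operator `M_{z_i}` on `H²(𝔻ⁿ)`. -/
def mulCoord {n : ℕ} (i : Fin n) : HardySpace n →L[ℂ] HardySpace n :=
  ((mulCoordL2 i).comp (HardySpace.incl n)).codRestrict (hardySubspace n)
    fun f => mulCoordL2_mem i (Subtype.property f)

/-- A quotient module of `H²(𝔻ⁿ)`: a closed subspace invariant under every `M_{z_i}^*`. -/
structure QuotientModule (n : ℕ) where
  /-- the underlying subspace -/
  space : Submodule ℂ (HardySpace n)
  isClosed : IsClosed (space : Set (HardySpace n))
  adjoint_mem : ∀ i : Fin n, ∀ f ∈ space, ContinuousLinearMap.adjoint (mulCoord i) f ∈ space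

instance {n : ℕ} (Q : QuotientModule n) : CompleteSpace Q.space :=
  Q.isClosed.completeSpace_coe

/-- The module multiplication operator by `z_i` on a quotient module `Q`: the compression
`P_Q M_{z_i}|_Q`. -/
def QuotientModule.compression {n : ℕ} (Q : QuotientModule n) (i : Fin n) :
    Q.space →L[ℂ] Q.space :=
  Q.space.orthogonalProjectionOnto ∘L mulCoord i ∘L Q.space.subtypeL

/-- `C_{z_i} C_{z_j}^* = C_{z_j}^* C_{z_i}` for all `i < j`. -/
def QuotientModule.DoublyCommuting {n : ℕ} (Q : QuotientModule n) : Prop :=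
  ∀ i j : Fin n, i < j →
    Q.compression i ∘L ContinuousLinearMap.adjoint (Q.compression j) =
      ContinuousLinearMap.adjoint (Q.compression j) ∘L Q.compression i

/-- `{0} ≠ Q ≠ H²(𝔻ⁿ)`. -/
def QuotientModule.Nontrivial {n : ℕ} (Q : QuotientModule n) : Prop :=
  Q.space ≠ ⊥ ∧ Q.space ≠ ⊤

/-! ### Bounded holomorphic functions on the disc and the class `C₀` -/

/-- `Θ ∈ H^∞(𝔻)`. Values of `Θ` outside the open unit disc are irrelevant. -/
def IsHInf (Θ : ℂ → ℂ) : Prop :=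
  DifferentiableOn ℂ Θ (Metric.ball 0 1) ∧ ∃ C : ℝ, ∀ z ∈ Metric.ball (0 : ℂ) 1, ‖Θ z‖ ≤ C

/-- `Θ` is not the zero function on the open unit disc. -/
def NonzeroOnDisc (Θ : ℂ → ℂ) : Prop := ∃ z ∈ Metric.ball (0 : ℂ) 1, Θ z ≠ 0

/-- `Θ` is an inner function: `Θ ∈ H^∞(𝔻)` with radial limits of modulus one almost everywhere
on the unit circle. -/
def IsInner (Θ : ℂ → ℂ) : Prop :=
  IsHInf Θ ∧ ∀ᵐ t ∂(AddCircle.haarAddCircle : Measure UnitAddCircle),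
    Tendsto (fun r : ℝ => ‖Θ ((r : ℂ) * fourier 1 t)‖) (𝓝[<] 1) (𝓝 1)

/-- The `k`-th Taylor coefficient of `Θ` at the origin. -/
def taylorCoeff (Θ : ℂ → ℂ) (k : ℕ) : ℂ := iteratedDeriv k Θ 0 / (Nat.factorial k : ℂ)

section Operators

variable {E : Type*} [NormedAddCommGroup E] [InnerProductSpace ℂ E] [CompleteSpace E]

/-- `T` is a completely non-unitary contraction: `‖T‖ ≤ 1`, and `{0}` is the only closed subspace
reducing `T` on which `T` is unitary. -/
def IsCNUContraction (T : E →L[ℂ] E) : Prop :=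
  ‖T‖ ≤ 1 ∧ ∀ M : Submodule ℂ E, IsClosed (M : Set E) →
    (∀ x ∈ M, T x ∈ M) → (∀ x ∈ M, ContinuousLinearMap.adjoint T x ∈ M) →
    (∀ x ∈ M, ContinuousLinearMap.adjoint T (T x) = x ∧
      T (ContinuousLinearMap.adjoint T x) = x) → M = ⊥

/-- `A = Θ(T)` in the Sz.-Nagy–Foias functional calculus: `A` is the strong limit, as `r ↑ 1`, of
`Θ(rT) = ∑ₖ aₖ rᵏ Tᵏ`, where `Θ(z) = ∑ₖ aₖ zᵏ`. (For a contraction `T`, a function `Θ ∈ H^∞(𝔻)`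
and `0 < r < 1` the series converges in operator norm; if `T` is completely non-unitary, then the
strong limit exists.) -/
def HasHInfValue (T : E →L[ℂ] E) (Θ : ℂ → ℂ) (A : E →L[ℂ] E) : Prop :=
  ∀ x : E, Tendsto (fun r : ℝ => (∑' k : ℕ, (taylorCoeff Θ k * (r : ℂ) ^ k) • T ^ k) x)
    (𝓝[<] 1) (𝓝 (A x))

/-- The class `C₀`: completely non-unitary contractions `T` such that `Θ(T) = 0` for some nonzero
`Θ ∈ H^∞(𝔻)`. -/
def IsClassC0 (T : E →L[ℂ] E) : Prop :=
  IsCNUContraction T ∧ ∃ Θ : ℂ → ℂ, IsHInf Θ ∧ NonzeroOnDisc Θ ∧ HasHInfValue T Θ 0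

end Operators

/-! ### Tensor products of Jordan blocks -/

/-- The coefficient of `z₁ ^ k₁ ⋯ zₙ ^ kₙ` in the power series of `f ∈ H²(𝔻ⁿ)`. -/
def hardyCoeff {n : ℕ} (f : HardySpace n) (k : Fin n → ℕ) : ℂ :=
  inner ℂ (monomialL2 k) (HardySpace.incl n f)

/-- The functions `Θ f`, `f ∈ H²(𝔻)`; the product is the Cauchy product of the power series. -/
def innerMultiples (Θ : ℂ → ℂ) : Set (HardySpace 1) :=
  {g | ∃ f : HardySpace 1, ∀ m : ℕ, hardyCoeff g (fun _ => m) =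
    ∑ j ∈ Finset.range (m + 1), taylorCoeff Θ j * hardyCoeff f (fun _ => m - j)}

/-- `Q_Θ = H²(𝔻) ⊖ Θ H²(𝔻)`: a Jordan block if `Θ` is inner, and `H²(𝔻)` if `Θ = 0`. -/
def jordanBlock (Θ : ℂ → ℂ) : Submodule ℂ (HardySpace 1) :=
  (Submodule.span ℂ (innerMultiples Θ))ᗮ

/-- The Hilbert space tensor product `Q_{Θ₁} ⊗ ⋯ ⊗ Q_{Θₙ}` inside `H²(𝔻ⁿ)`: the closed span of the
functions `f₁(z₁) ⋯ fₙ(zₙ)` with `f_i ∈ Q_{Θ_i}`. -/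
def tensorJordanBlocks {n : ℕ} (Θ : Fin n → ℂ → ℂ) : Submodule ℂ (HardySpace n) :=
  (Submodule.span ℂ {F : HardySpace n | ∃ f : Fin n → HardySpace 1,
    (∀ i, f i ∈ jordanBlock (Θ i)) ∧
    ∀ k : Fin n → ℕ, hardyCoeff F k = ∏ i, hardyCoeff (f i) (fun _ => k i)}).topologicalClosure

/-- `Θ₁, …, Θₙ` are representing functions of `Q`: each is inner or zero, and
`Q = Q_{Θ₁} ⊗ ⋯ ⊗ Q_{Θₙ}`. -/
def QuotientModule.IsRepresentedBy {n : ℕ} (Q : QuotientModule n) (Θ : Fin n → ℂ → ℂ) : Prop :=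
  (∀ i, IsInner (Θ i) ∨ ∀ z ∈ Metric.ball (0 : ℂ) 1, Θ i z = 0) ∧
    Q.space = tensorJordanBlocks Θ

end HardyPolydisc

end

noncomputable section

namespace HardyPolydisc

open ContinuousLinearMap

/-! Both assertions rest on one criterion, `hasHInfValue_zero`: if Θ ∈ H^∞ and Θ(z_i) ⊥ Q, then
Θ(C_{z_i}) = 0. The operators Θ(rM_{z_i}) are bounded by sup |Θ|, their values at 1 tend to Θ(z_i),
and Qᗮ is a submodule; so convergence to 0 after projecting to Q spreads from 1 to all monomials and
to their closed span. Complete non-unitarity holds for every i.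

For representing functions, Q ≠ H² prevents all Θ_i from vanishing, and Θ_i(z_i) is orthogonal to
the tensor product.

Existence needs no tensor factorization. If for some i there are nonzero functions of z_i alone in
Qᗮ, they form a z_i-invariant subspace, and Beurling's wandering vector argument yields a bounded
one (`exists_isHInf_of_invariant`).

Otherwise Q = H² (`space_eq_top`). Let P project onto Q and E onto the functions of z_i alone.
Double commutation makes PEP commute with C_{z_i}, so z_i E P f - E P z_i f is a function of z_i in
Qᗮ, hence 0. Self-adjointness then gives E P = c on powers of z_i, and comparing defect operators
gives M_{z_i}^* P1 = 0. As this holds for all i, P1 is a nonzero constant. Thus 1 ∈ Q and c = 1, all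
powers of single variables lie in Q, and double commutation supplies the mixed monomials. -/

theorem integral_mFourier {n : ℕ} (m : Fin n → ℤ) :
    ∫ x, UnitAddTorus.mFourier m x ∂(torusMeasure n) = if m = 0 then 1 else 0 := by
  split_ifs with h
  · simp [h, UnitAddTorus.mFourier_zero]
  · simp only [UnitAddTorus.mFourier, ContinuousMap.coe_mk]
    rw [integral_fintype_prod_eq_prod (fun i (x : UnitAddCircle) => fourier (m i) x)]
    obtain ⟨i, hi⟩ := Function.ne_iff.mp h
    apply Finset.prod_eq_zero (Finset.mem_univ i)
    have := orthonormal_iff_ite.mp (orthonormal_fourier (T := 1)) 0 (m i)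
    rw [if_neg (by simpa using hi.symm), ContinuousMap.inner_toLp] at this
    simpa using this

theorem orthonormal_monomialL2 (n : ℕ) : Orthonormal ℂ (monomialL2 (n := n)) := by
  rw [orthonormal_iff_ite]
  intro k l
  simp only [monomialL2, ContinuousMap.inner_toLp, ← UnitAddTorus.mFourier_neg,
    ← UnitAddTorus.mFourier_add]
  rw [integral_mFourier]
  refine if_congr ?_ rfl rfl
  rw [add_neg_eq_zero]
  constructor
  · intro h
    funext i
    exact_mod_cast (congrFun h i).symm
  · rintro rfl
    rfl

/-- The monomial `z₁ ^ k₁ ⋯ zₙ ^ kₙ` as an element of `H²(𝔻ⁿ)`. -/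
def monomial {n : ℕ} (k : Fin n → ℕ) : HardySpace n :=
  ⟨monomialL2 k, Submodule.le_topologicalClosure _ (Submodule.subset_span ⟨k, rfl⟩)⟩

theorem inner_incl {n : ℕ} (f g : HardySpace n) :
    inner ℂ (HardySpace.incl n f) (HardySpace.incl n g) = inner ℂ f g := rfl

theorem hardyCoeff_eq_inner {n : ℕ} (f : HardySpace n) (k : Fin n → ℕ) :
    hardyCoeff f k = inner ℂ (monomial k) f := rfl

theorem orthonormal_monomial (n : ℕ) : Orthonormal ℂ (monomial (n := n)) := by
  rw [orthonormal_iff_ite]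
  intro k l
  rw [← inner_incl]
  exact orthonormal_iff_ite.1 (orthonormal_monomialL2 n) k l

theorem span_monomial_topologicalClosure (n : ℕ) :
    (Submodule.span ℂ (Set.range (monomial (n := n)))).topologicalClosure = ⊤ := by
  rw [eq_top_iff]
  intro f _
  change f ∈ closure _
  have hind : IsInducing (HardySpace.incl n) := IsInducing.subtypeVal
  rw [hind.closure_eq_preimage_closure_image, Set.mem_preimage]
  have : (HardySpace.incl n) '' (Submodule.span ℂ (Set.range (monomial (n := n))) : Set _) =
      (Submodule.span ℂ (Set.range (monomialL2 (n := n))) : Set _) := by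
    have h := Submodule.map_span (HardySpace.incl n : HardySpace n →ₗ[ℂ] L2Torus n)
      (Set.range (monomial (n := n)))
    rw [← Set.range_comp] at h
    exact congrArg (fun s : Submodule ℂ (L2Torus n) => (s : Set (L2Torus n))) h
  exact this.symm ▸ f.2

/-- The monomials as a Hilbert basis of `H²(𝔻ⁿ)`. -/
def monomialBasis (n : ℕ) : HilbertBasis (Fin n → ℕ) ℂ (HardySpace n) :=
  HilbertBasis.mk (orthonormal_monomial n) (span_monomial_topologicalClosure n).ge

@[simp]
theorem coe_monomialBasis (n : ℕ) : ⇑(monomialBasis n) = monomial := HilbertBasis.coe_mk _ _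

theorem monomialBasis_repr {n : ℕ} (f : HardySpace n) (k : Fin n → ℕ) :
    (monomialBasis n).repr f k = hardyCoeff f k := by
  rw [HilbertBasis.repr_apply_apply, coe_monomialBasis, hardyCoeff_eq_inner]

theorem hardyCoeff_ext {n : ℕ} {f g : HardySpace n} (h : ∀ k, hardyCoeff f k = hardyCoeff g k) :
    f = g := by
  apply (monomialBasis n).repr.injective
  ext k
  rw [monomialBasis_repr, monomialBasis_repr, h]

theorem exists_eq_add_single {n : ℕ} {i : Fin n} {k : Fin n → ℕ} (hk : k i ≠ 0) :
    ∃ l : Fin n → ℕ, k = l + Pi.single i 1 := by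
  refine ⟨k - Pi.single i 1, funext fun a => ?_⟩
  change k a = k a - (Pi.single i 1 : Fin n → ℕ) a + (Pi.single i 1 : Fin n → ℕ) a
  by_cases ha : a = i
  · subst ha
    rw [Pi.single_eq_same]
    omega
  · simp [ha]

theorem hardyCoeff_monomial {n : ℕ} (k l : Fin n → ℕ) :
    hardyCoeff (monomial k) l = if l = k then 1 else 0 :=
  orthonormal_iff_ite.1 (orthonormal_monomial n) l k

theorem norm_monomial {n : ℕ} (k : Fin n → ℕ) : ‖monomial k‖ = 1 := (orthonormal_monomial n).1 k

theorem mem_of_monomial_mem {n : ℕ} {K : Submodule ℂ (HardySpace n)}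
    (hK : IsClosed (K : Set (HardySpace n))) (h : ∀ k, monomial k ∈ K) : K = ⊤ := by
  rw [eq_top_iff, ← span_monomial_topologicalClosure]
  exact Submodule.topologicalClosure_minimal _ (Submodule.span_le.2 (by rintro _ ⟨k, rfl⟩; exact h k)) hK

theorem clm_ext_monomial {n : ℕ} {F : Type*} [NormedAddCommGroup F] [NormedSpace ℂ F]
    {A B : HardySpace n →L[ℂ] F}
    (h : ∀ k, A (monomial k) = B (monomial k)) : A = B := by
  refine ContinuousLinearMap.ext_on (s := Set.range (monomial (n := n))) ?_ ?_
  · have := (monomialBasis n).dense_span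
    rw [coe_monomialBasis] at this
    exact (Submodule.dense_iff_topologicalClosure_eq_top).2 this
  · rintro _ ⟨k, rfl⟩
    exact h k

/-! ### The coordinate multiplications as commuting isometric shifts. -/

theorem mulCoord_monomial {n : ℕ} (i : Fin n) (k : Fin n → ℕ) :
    mulCoord i (monomial k) = monomial (k + Pi.single i 1) :=
  Subtype.ext (mulCoordL2_monomialL2 i k)

theorem mulCoord_pow_monomial {n : ℕ} (i : Fin n) (k : Fin n → ℕ) (m : ℕ) :
    (mulCoord i ^ m) (monomial k) = monomial (k + Pi.single i m) := by
  induction m with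
  | zero => simp
  | succ m ih =>
    rw [pow_succ', mul_apply_eq_comp, ih, mulCoord_monomial, add_assoc,
      ← Pi.single_add]

theorem incl_mulCoord {n : ℕ} (i : Fin n) (f : HardySpace n) :
    HardySpace.incl n (mulCoord i f) = mulCoordL2 i (HardySpace.incl n f) := rfl

theorem hardyCoeff_adjoint_mulCoord {n : ℕ} (i : Fin n) (f : HardySpace n) (k : Fin n → ℕ) :
    hardyCoeff (adjoint (mulCoord i) f) k = hardyCoeff f (k + Pi.single i 1) := by
  rw [hardyCoeff_eq_inner, adjoint_inner_right, mulCoord_monomial, hardyCoeff_eq_inner]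

theorem adjoint_mulCoord_monomial_eq_zero {n : ℕ} {i : Fin n} {k : Fin n → ℕ} (hk : k i = 0) :
    adjoint (mulCoord i) (monomial k) = 0 := by
  refine hardyCoeff_ext fun l => ?_
  rw [hardyCoeff_adjoint_mulCoord, hardyCoeff_monomial, if_neg]
  · simp [hardyCoeff_eq_inner]
  · rintro rfl
    simp at hk

theorem adjoint_mulCoord_mul_mulCoord {n : ℕ} (i : Fin n) :
    adjoint (mulCoord i) * mulCoord i = 1 := by
  refine clm_ext_monomial fun k => hardyCoeff_ext fun l => ?_
  simp [hardyCoeff_adjoint_mulCoord, mulCoord_monomial, hardyCoeff_monomial]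

theorem adjoint_mulCoord_mulCoord {n : ℕ} (i : Fin n) (f : HardySpace n) :
    adjoint (mulCoord i) (mulCoord i f) = f :=
  congrArg (fun A : HardySpace n →L[ℂ] HardySpace n => A f) (adjoint_mulCoord_mul_mulCoord i)

theorem inner_mulCoord {n : ℕ} (i : Fin n) (f g : HardySpace n) :
    inner ℂ (mulCoord i f) (mulCoord i g) = inner ℂ f g := by
  rw [← ContinuousLinearMap.adjoint_inner_right, adjoint_mulCoord_mulCoord]

theorem norm_mulCoord_apply {n : ℕ} (i : Fin n) (f : HardySpace n) : ‖mulCoord i f‖ = ‖f‖ := by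
  rw [@norm_eq_sqrt_re_inner ℂ, inner_mulCoord, ← norm_eq_sqrt_re_inner]

theorem mulCoord_mul_comm {n : ℕ} (i j : Fin n) :
    mulCoord i * mulCoord j = mulCoord j * mulCoord (n := n) i := by
  refine clm_ext_monomial fun k => ?_
  simp [mulCoord_monomial, add_right_comm]

theorem hardyCoeff_mulCoord_of_eq_zero {n : ℕ} (i : Fin n) (f : HardySpace n) {k : Fin n → ℕ}
    (hk : k i = 0) : hardyCoeff (mulCoord i f) k = 0 := by
  rw [hardyCoeff_eq_inner, ← adjoint_inner_left, adjoint_mulCoord_monomial_eq_zero hk, inner_zero_left]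

theorem norm_mulCoord_le {n : ℕ} (i : Fin n) : ‖mulCoord (n := n) i‖ ≤ 1 :=
  opNorm_le_bound _ zero_le_one fun f => by rw [norm_mulCoord_apply, one_mul]

/-! ### Compressions to a quotient module and complete non-unitarity. -/

namespace QuotientModule

variable {n : ℕ} (Q : QuotientModule n)

/-- The orthogonal projection of `H²(𝔻ⁿ)` onto a quotient module. -/
abbrev proj : HardySpace n →L[ℂ] HardySpace n := Q.space.starProjection

theorem coe_compression_apply (i : Fin n) (x : Q.space) :
    (Q.compression i x : HardySpace n) = Q.proj (mulCoord i x) := rfl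

theorem coe_adjoint_compression_apply (i : Fin n) (x : Q.space) :
    (adjoint (Q.compression i) x : HardySpace n) = adjoint (mulCoord i) x := by
  have : adjoint (Q.compression i) x = ⟨adjoint (mulCoord i) x, Q.adjoint_mem i x x.2⟩ := by
    refine ext_inner_left ℂ fun y => ?_
    rw [adjoint_inner_right, Submodule.coe_inner, coe_compression_apply,
      Submodule.inner_starProjection_left_eq_right,
      Submodule.starProjection_eq_self_iff.2 x.2, ← adjoint_inner_right, Submodule.coe_inner]
  rw [this]

theorem mulCoord_mem_orthogonal (i : Fin n) {f : HardySpace n} (hf : f ∈ Q.spaceᗮ) :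
    mulCoord i f ∈ Q.spaceᗮ := by
  rw [Submodule.mem_orthogonal] at hf ⊢
  intro u hu
  rw [← adjoint_inner_left]
  exact hf _ (Q.adjoint_mem i u hu)

/-- The component of f in Qᗮ stays there under multiplication. This is why powers of the compression
are compressions of powers. -/
theorem proj_mulCoord_proj (i : Fin n) (f : HardySpace n) :
    Q.proj (mulCoord i (Q.proj f)) = Q.proj (mulCoord i f) := by
  have h := Q.mulCoord_mem_orthogonal i (Q.space.sub_starProjection_mem_orthogonal f)
  rw [map_sub] at h
  have h2 := (Submodule.starProjection_apply_eq_zero_iff _).2 h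
  rw [map_sub, sub_eq_zero] at h2
  exact h2.symm

theorem coe_compression_pow_apply (i : Fin n) (x : Q.space) (k : ℕ) :
    ((Q.compression i ^ k) x : HardySpace n) = Q.proj ((mulCoord i ^ k) x) := by
  induction k with
  | zero => exact (Submodule.starProjection_eq_self_iff.2 x.2).symm
  | succ k ih =>
    rw [pow_succ', pow_succ', mul_apply_eq_comp, mul_apply_eq_comp,
      coe_compression_apply, ih, proj_mulCoord_proj]

theorem norm_compression_le (i : Fin n) : ‖Q.compression i‖ ≤ 1 := by
  refine opNorm_le_bound _ zero_le_one fun x => ?_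
  rw [one_mul]
  exact (Q.space.norm_starProjection_apply_le _).trans (norm_mulCoord_apply i _).le

/-- The projection of M M^* x onto Q is x, while ‖M M^* x‖ = ‖M^* x‖ ≤ ‖x‖. The projection therefore
loses no norm, so M M^* x already lies in Q. -/
theorem eq_mulCoord_adjoint_of_compression_eq (i : Fin n) {x : Q.space}
    (hx : Q.compression i (adjoint (Q.compression i) x) = x) :
    mulCoord i (adjoint (mulCoord i) x) = (x : HardySpace n) := by
  have h1 : Q.proj (mulCoord i (adjoint (mulCoord i) x)) = x := by
    rw [← coe_adjoint_compression_apply, ← coe_compression_apply, hx]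
  have h2 : ‖adjoint (mulCoord i) (x : HardySpace n)‖ ≤ ‖x‖ := by
    have := (adjoint (mulCoord i)).le_opNorm (x : HardySpace n)
    rw [LinearIsometryEquiv.norm_map] at this
    exact this.trans (mul_le_of_le_one_left (norm_nonneg _) (norm_mulCoord_le i))
  have h3 : mulCoord i (adjoint (mulCoord i) x) ∈ Q.space := by
    rw [Submodule.mem_iff_norm_starProjection]
    refine le_antisymm (Q.space.norm_starProjection_apply_le _) ?_
    change _ ≤ ‖Q.proj _‖
    rw [h1, norm_mulCoord_apply]
    exact h2
  refine Eq.trans ?_ h1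
  exact (Submodule.starProjection_eq_self_iff.2 h3).symm

/-- On a unitary part every x equals M M^* x, so it has no coefficients with k_i = 0. The adjoint
preserves this part and lowers k_i, so all coefficients vanish by induction on k_i. -/
theorem isCNUContraction_compression (i : Fin n) : IsCNUContraction (Q.compression i) := by
  refine ⟨Q.norm_compression_le i, fun M _ _ hM' hu => ?_⟩
  have key : ∀ m : ℕ, ∀ x ∈ M, ∀ k : Fin n → ℕ, k i = m → hardyCoeff (x : HardySpace n) k = 0 := by
    intro m
    induction m with
    | zero =>
      intro x hx k hk
      rw [← Q.eq_mulCoord_adjoint_of_compression_eq i (hu x hx).2]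
      exact hardyCoeff_mulCoord_of_eq_zero i _ hk
    | succ m ih =>
      intro x hx k hk
      obtain ⟨l, rfl⟩ : ∃ l, k = l + Pi.single i 1 := exists_eq_add_single (by omega)
      rw [← hardyCoeff_adjoint_mulCoord, ← coe_adjoint_compression_apply]
      exact ih _ (hM' x hx) _ (by simpa using hk)
  rw [eq_bot_iff]
  intro x hx
  rw [Submodule.mem_bot]
  refine Subtype.ext (hardyCoeff_ext fun k => ?_)
  rw [key _ x hx k rfl]
  simp [hardyCoeff_eq_inner]

end QuotientModule

/-! ### Abel sums of the Taylor series of a bounded holomorphic function -/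

theorem hasSum_taylorCoeff {Θ : ℂ → ℂ} (hΘ : DifferentiableOn ℂ Θ (Metric.ball 0 1)) {z : ℂ}
    (hz : ‖z‖ < 1) : HasSum (fun k => taylorCoeff Θ k * z ^ k) (Θ z) := by
  have h := Complex.hasSum_taylorSeries_on_ball hΘ (z := z) (by simpa using hz)
  refine h.congr_fun fun k => ?_
  simp only [taylorCoeff, sub_zero, smul_eq_mul]
  ring

theorem summable_norm_taylorCoeff {Θ : ℂ → ℂ} (hΘ : DifferentiableOn ℂ Θ (Metric.ball 0 1))
    {r : ℝ} (h0 : 0 ≤ r) (h1 : r < 1) : Summable fun k => ‖taylorCoeff Θ k * (r : ℂ) ^ k‖ :=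
  (hasSum_taylorCoeff hΘ (z := r) (by simpa [abs_of_nonneg h0] using h1)).summable.norm

section AbelSum

variable {E : Type*} [NormedAddCommGroup E] [InnerProductSpace ℂ E]

/-- The operator `Θ(rT) = ∑ₖ aₖ rᵏ Tᵏ`, where `Θ(z) = ∑ₖ aₖ zᵏ`. -/
def abelSum (T : E →L[ℂ] E) (Θ : ℂ → ℂ) (r : ℝ) : E →L[ℂ] E :=
  ∑' k : ℕ, (taylorCoeff Θ k * (r : ℂ) ^ k) • T ^ k

variable [CompleteSpace E]

theorem summable_abelSum {T : E →L[ℂ] E} (hT : ‖T‖ ≤ 1) {Θ : ℂ → ℂ}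
    (hΘ : DifferentiableOn ℂ Θ (Metric.ball 0 1)) {r : ℝ} (h0 : 0 ≤ r) (h1 : r < 1) :
    Summable fun k : ℕ => (taylorCoeff Θ k * (r : ℂ) ^ k) • T ^ k := by
  refine Summable.of_norm_bounded (summable_norm_taylorCoeff hΘ h0 h1) fun k => ?_
  rw [norm_smul]
  refine mul_le_of_le_one_right (norm_nonneg _) ?_
  rcases k with _ | k
  · exact norm_id_le
  · exact (norm_pow_le' T k.succ_pos).trans (pow_le_one₀ (norm_nonneg _) hT)

theorem hasSum_abelSum_apply {T : E →L[ℂ] E} (hT : ‖T‖ ≤ 1) {Θ : ℂ → ℂ}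
    (hΘ : DifferentiableOn ℂ Θ (Metric.ball 0 1)) {r : ℝ} (h0 : 0 ≤ r) (h1 : r < 1) (x : E) :
    HasSum (fun k : ℕ => (taylorCoeff Θ k * (r : ℂ) ^ k) • (T ^ k) x) (abelSum T Θ r x) := by
  have h : HasSum (fun k : ℕ => (taylorCoeff Θ k * (r : ℂ) ^ k) • T ^ k) (abelSum T Θ r) :=
    (summable_abelSum hT hΘ h0 h1).hasSum
  exact h.mapL (ContinuousLinearMap.apply ℂ E x)

end AbelSum

/-- Multiplication by a continuous function on `L²(𝕋ⁿ)`. -/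
def mulContinuousL2 (n : ℕ) : C(UnitAddTorus (Fin n), ℂ) →L[ℂ] L2Torus n →L[ℂ] L2Torus n :=
  (ContinuousLinearMap.mul ℂ ℂ).holderL (torusMeasure n) ∞ 2 2 ∘L
    ContinuousMap.toLp (E := ℂ) ∞ (torusMeasure n) ℂ

theorem mulContinuousL2_single {n : ℕ} (i : Fin n) :
    mulContinuousL2 n (UnitAddTorus.mFourier (Pi.single i 1)) = mulCoordL2 i := rfl

theorem coeFn_mulContinuousL2 {n : ℕ} (g : C(UnitAddTorus (Fin n), ℂ)) (f : L2Torus n) :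
    mulContinuousL2 n g f =ᵐ[torusMeasure n] fun x => g x * f x := by
  filter_upwards [ContinuousLinearMap.coeFn_holder (r := 2) (ContinuousLinearMap.mul ℂ ℂ)
      (ContinuousMap.toLp (E := ℂ) ∞ (torusMeasure n) ℂ g) f,
    ContinuousMap.coeFn_toLp (E := ℂ) (p := ∞) (𝕜 := ℂ) (torusMeasure n) g] with x h1 h2
  rw [← h2]
  exact h1

theorem norm_mulContinuousL2_le {n : ℕ} (g : C(UnitAddTorus (Fin n), ℂ)) :
    ‖mulContinuousL2 n g‖ ≤ ‖g‖ := by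
  refine opNorm_le_bound _ (norm_nonneg _) fun f => ?_
  refine Lp.norm_le_mul_norm_of_ae_le_mul ?_
  filter_upwards [coeFn_mulContinuousL2 g f] with x hx
  rw [hx, norm_mul]
  gcongr
  exact g.norm_coe_le_norm x

theorem mulContinuousL2_pow {n : ℕ} (g : C(UnitAddTorus (Fin n), ℂ)) (k : ℕ) :
    mulContinuousL2 n (g ^ k) = mulContinuousL2 n g ^ k := by
  induction k with
  | zero =>
    refine ContinuousLinearMap.ext fun f => Lp.ext ?_
    filter_upwards [coeFn_mulContinuousL2 (g ^ 0) f] with x hx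
    rw [hx]
    simp
  | succ k ih =>
    refine ContinuousLinearMap.ext fun f => Lp.ext ?_
    rw [pow_succ' (mulContinuousL2 n g), ← ih, mul_apply_eq_comp]
    filter_upwards [coeFn_mulContinuousL2 (g ^ (k + 1)) f,
      coeFn_mulContinuousL2 g (mulContinuousL2 n (g ^ k) f),
      coeFn_mulContinuousL2 (g ^ k) f] with x h1 h2 h3
    rw [h1, h2, h3, pow_succ', ContinuousMap.mul_apply, mul_assoc]

theorem norm_mulCoordL2_le {n : ℕ} (i : Fin n) : ‖mulCoordL2 (n := n) i‖ ≤ 1 := by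
  rw [← mulContinuousL2_single]
  exact (norm_mulContinuousL2_le _).trans UnitAddTorus.mFourier_norm.le

/-- On L²(𝕋ⁿ) the Abel sum is multiplication by the continuous function Θ(r z_i), whose values are
values of Θ inside the disc. The bound on H² follows by restriction. -/
theorem norm_abelSum_mulCoordL2_le {n : ℕ} (i : Fin n) {Θ : ℂ → ℂ}
    (hΘ : DifferentiableOn ℂ Θ (Metric.ball 0 1)) {C : ℝ}
    (hC : ∀ z ∈ Metric.ball (0 : ℂ) 1, ‖Θ z‖ ≤ C) {r : ℝ} (h0 : 0 ≤ r) (h1 : r < 1) :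
    ‖abelSum (mulCoordL2 (n := n) i) Θ r‖ ≤ C := by
  have hC0 : 0 ≤ C := (norm_nonneg _).trans (hC 0 (by simp))
  set z : C(UnitAddTorus (Fin n), ℂ) := UnitAddTorus.mFourier (Pi.single i 1) with hz
  have hsum : Summable fun k : ℕ => (taylorCoeff Θ k * (r : ℂ) ^ k) • z ^ k := by
    refine Summable.of_norm_bounded (summable_norm_taylorCoeff hΘ h0 h1) fun k => ?_
    rw [norm_smul]
    refine mul_le_of_le_one_right (norm_nonneg _) ((norm_pow_le _ _).trans ?_)
    rw [hz, UnitAddTorus.mFourier_norm, one_pow]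
  have heq : abelSum (mulCoordL2 (n := n) i) Θ r =
      mulContinuousL2 n (∑' k : ℕ, (taylorCoeff Θ k * (r : ℂ) ^ k) • z ^ k) := by
    rw [(mulContinuousL2 n).map_tsum hsum]
    simp only [map_smul, mulContinuousL2_pow, hz, mulContinuousL2_single]
    rfl
  rw [heq]
  refine (norm_mulContinuousL2_le _).trans ((ContinuousMap.norm_le _ hC0).2 fun x => ?_)
  have hx : ‖z x‖ ≤ 1 := (z.norm_coe_le_norm x).trans UnitAddTorus.mFourier_norm.le
  have hlt : ‖(r : ℂ) * z x‖ < 1 := by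
    rw [norm_mul, Complex.norm_real, Real.norm_of_nonneg h0]
    exact (mul_le_of_le_one_right h0 hx).trans_lt h1
  have h2 : HasSum (fun k : ℕ => ((taylorCoeff Θ k * (r : ℂ) ^ k) • z ^ k) x)
      ((∑' k : ℕ, (taylorCoeff Θ k * (r : ℂ) ^ k) • z ^ k) x) :=
    ContinuousMap.hasSum_apply hsum.hasSum x
  have h3 := hasSum_taylorCoeff hΘ hlt
  rw [h2.unique (h3.congr_fun fun k => ?_)]
  · exact hC _ (by simpa using hlt)
  · simp [mul_pow, mul_assoc]

theorem incl_pow_mulCoord {n : ℕ} (i : Fin n) (f : HardySpace n) (k : ℕ) :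
    HardySpace.incl n ((mulCoord i ^ k) f) = (mulCoordL2 i ^ k) (HardySpace.incl n f) := by
  induction k with
  | zero => rfl
  | succ k ih =>
    rw [pow_succ', pow_succ', mul_apply_eq_comp, mul_apply_eq_comp, incl_mulCoord, ih]

theorem norm_incl {n : ℕ} (f : HardySpace n) : ‖HardySpace.incl n f‖ = ‖f‖ := rfl

theorem norm_abelSum_mulCoord_le {n : ℕ} (i : Fin n) {Θ : ℂ → ℂ}
    (hΘ : DifferentiableOn ℂ Θ (Metric.ball 0 1)) {C : ℝ}
    (hC : ∀ z ∈ Metric.ball (0 : ℂ) 1, ‖Θ z‖ ≤ C) {r : ℝ} (h0 : 0 ≤ r) (h1 : r < 1) :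
    ‖abelSum (mulCoord (n := n) i) Θ r‖ ≤ C := by
  have hC0 : 0 ≤ C := (norm_nonneg _).trans (hC 0 (by simp))
  refine opNorm_le_bound _ hC0 fun f => ?_
  have h2 := (HardySpace.incl n).hasSum (hasSum_abelSum_apply (norm_mulCoord_le i) hΘ h0 h1 f)
  have h3 := hasSum_abelSum_apply (norm_mulCoordL2_le i) hΘ h0 h1 (HardySpace.incl n f)
  have h4 := h2.unique (h3.congr_fun fun k => by rw [map_smul, incl_pow_mulCoord])
  rw [← norm_incl, h4, ← norm_incl f]
  exact (le_opNorm _ _).trans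
    (mul_le_mul_of_nonneg_right (norm_abelSum_mulCoordL2_le i hΘ hC h0 h1) (norm_nonneg _))

/-! ### Series along an orthonormal family. -/

section Orthonormal

variable {ι E : Type*} [NormedAddCommGroup E] [InnerProductSpace ℂ E] {u : ι → E}

theorem inner_of_hasSum (hu : Orthonormal ℂ u) {c : ι → ℂ} {w : E}
    (hw : HasSum (fun k => c k • u k) w) (k : ι) : inner ℂ (u k) w = c k := by
  classical
  have h := hw.mapL (innerSL ℂ (u k))
  refine h.unique ((hasSum_ite_eq k (c k)).congr_fun fun l => ?_)
  rw [innerSL_apply_apply, inner_smul_right, orthonormal_iff_ite.1 hu]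
  by_cases hkl : l = k
  · simp [hkl]
  · simp [hkl, Ne.symm hkl]

theorem hasSum_norm_sq_of_hasSum (hu : Orthonormal ℂ u) {c : ι → ℂ} {w : E}
    (hw : HasSum (fun k => c k • u k) w) : HasSum (fun k => ‖c k‖ ^ 2) (‖w‖ ^ 2) := by
  have h := hw.mapL (innerSL ℂ w)
  rw [innerSL_apply_apply, inner_self_eq_norm_sq_to_K] at h
  have h2 : ∀ k, innerSL ℂ w (c k • u k) = ((‖c k‖ ^ 2 : ℝ) : ℂ) := by
    intro k
    rw [innerSL_apply_apply, inner_smul_right, ← inner_conj_symm, inner_of_hasSum hu hw,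
      Complex.mul_conj, Complex.normSq_eq_norm_sq]
  simp only [h2] at h
  have h3 := Complex.hasSum_re h
  have h4 : (((‖w‖ : ℝ) : ℂ) ^ 2).re = ‖w‖ ^ 2 := by rw [← Complex.ofReal_pow, Complex.ofReal_re]
  simp only [Complex.ofReal_re] at h3
  exact h4 ▸ h3

theorem exists_hasSum_of_summable_norm_sq [CompleteSpace E] (hu : Orthonormal ℂ u) {c : ι → ℂ}
    (hc : Summable fun k => ‖c k‖ ^ 2) : ∃ w, HasSum (fun k => c k • u k) w := by
  have h := (hu.orthogonalFamily.summable_iff_norm_sq_summable c).2 hc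
  exact h

end Orthonormal

/-! ### Square-summable Taylor coefficients and the limit of Θ(rM)1. -/

theorem orthonormal_monomial_single {n : ℕ} (i : Fin n) :
    Orthonormal ℂ fun k : ℕ => (monomial (Pi.single i k) : HardySpace n) :=
  (orthonormal_monomial n).comp _ fun _ _ h => Pi.single_injective i h

theorem mulCoord_pow_monomial_zero {n : ℕ} (i : Fin n) (k : ℕ) :
    (mulCoord i ^ k) (monomial 0) = monomial (Pi.single i k) := by
  rw [mulCoord_pow_monomial, zero_add]

theorem hasSum_abelSum_monomial_zero {n : ℕ} (i : Fin n) {Θ : ℂ → ℂ}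
    (hΘ : DifferentiableOn ℂ Θ (Metric.ball 0 1)) {r : ℝ} (h0 : 0 ≤ r) (h1 : r < 1) :
    HasSum (fun k : ℕ => (taylorCoeff Θ k * (r : ℂ) ^ k) • (monomial (Pi.single i k) : HardySpace n))
      (abelSum (mulCoord i) Θ r (monomial 0)) := by
  simpa only [mulCoord_pow_monomial_zero] using
    hasSum_abelSum_apply (norm_mulCoord_le i) hΘ h0 h1 (monomial 0)

theorem eventually_mem_Ico_zero_one : ∀ᶠ r : ℝ in 𝓝[<] 1, 0 ≤ r ∧ r < 1 := by
  filter_upwards [self_mem_nhdsWithin, mem_nhdsWithin_of_mem_nhds (Ioi_mem_nhds zero_lt_one)]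
    with r h1 h0
  exact ⟨le_of_lt h0, h1⟩

theorem tendsto_ofReal_pow (k : ℕ) :
    Tendsto (fun r : ℝ => (r : ℂ) ^ k) (𝓝[<] 1) (𝓝 1) := by
  have : Tendsto (fun r : ℝ => (r : ℂ) ^ k) (𝓝 1) (𝓝 (((1 : ℝ) : ℂ) ^ k)) :=
    ((Complex.continuous_ofReal.pow k).tendsto 1)
  simpa using this.mono_left nhdsWithin_le_nhds

/-- In one variable, ∑ |a_k|² r^{2k} = ‖Θ(rM)1‖² ≤ C². Let r ↑ 1 in finite partial sums. -/
theorem summable_norm_sq_taylorCoeff {Θ : ℂ → ℂ} (hΘ : IsHInf Θ) :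
    Summable fun k => ‖taylorCoeff Θ k‖ ^ 2 := by
  obtain ⟨hd, C, hC⟩ := hΘ
  refine summable_of_sum_le (c := C ^ 2) (fun _ => by positivity) fun s => ?_
  have hlim : Tendsto (fun r : ℝ => ∑ k ∈ s, ‖taylorCoeff Θ k * (r : ℂ) ^ k‖ ^ 2) (𝓝[<] 1)
      (𝓝 (∑ k ∈ s, ‖taylorCoeff Θ k‖ ^ 2)) := by
    refine tendsto_finsetSum _ fun k _ => ?_
    have := (((tendsto_ofReal_pow k).const_mul (taylorCoeff Θ k)).norm).pow 2
    simpa using this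
  refine le_of_tendsto hlim ?_
  filter_upwards [eventually_mem_Ico_zero_one] with r hr
  have h := hasSum_norm_sq_of_hasSum (orthonormal_monomial_single (0 : Fin 1))
    (hasSum_abelSum_monomial_zero (0 : Fin 1) hd hr.1 hr.2)
  refine (sum_le_hasSum s (fun _ _ => by positivity) h).trans ?_
  gcongr
  refine (le_opNorm _ _).trans ?_
  rw [norm_monomial, mul_one]
  exact norm_abelSum_mulCoord_le _ hd hC hr.1 hr.2

/-- By Parseval the squared distance is ∑ |a_k|² |r^k - 1|², which is dominated by ∑ |a_k|². -/
theorem tendsto_abelSum_monomial_zero {n : ℕ} (i : Fin n) {Θ : ℂ → ℂ} (hΘ : IsHInf Θ)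
    {v : HardySpace n}
    (hv : HasSum (fun k : ℕ => taylorCoeff Θ k • (monomial (Pi.single i k) : HardySpace n)) v) :
    Tendsto (fun r : ℝ => abelSum (mulCoord i) Θ r (monomial 0)) (𝓝[<] 1) (𝓝 v) := by
  rw [tendsto_iff_norm_sub_tendsto_zero]
  have hlim : Tendsto (fun r : ℝ => ∑' k, ‖taylorCoeff Θ k * ((r : ℂ) ^ k - 1)‖ ^ 2) (𝓝[<] 1)
      (𝓝 (∑' _ : ℕ, (0 : ℝ))) := by
    refine tendsto_tsum_of_dominated_convergence (summable_norm_sq_taylorCoeff hΘ) (fun k => ?_) ?_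
    · have := ((((tendsto_ofReal_pow k).sub_const 1).const_mul (taylorCoeff Θ k)).norm).pow 2
      simpa using this
    · filter_upwards [eventually_mem_Ico_zero_one] with r hr k
      rw [norm_pow, norm_norm, norm_mul]
      gcongr
      refine mul_le_of_le_one_right (norm_nonneg _) ?_
      have h1 : r ^ k ≤ 1 := pow_le_one₀ hr.1 hr.2.le
      have h2 : 0 ≤ r ^ k := pow_nonneg hr.1 k
      rw [show (r : ℂ) ^ k - 1 = ((r ^ k - 1 : ℝ) : ℂ) by push_cast; rfl, Complex.norm_real,
        Real.norm_eq_abs, abs_le]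
      constructor <;> linarith
  rw [tsum_zero] at hlim
  have h2 := hlim.sqrt
  rw [Real.sqrt_zero] at h2
  refine h2.congr' ?_
  filter_upwards [eventually_mem_Ico_zero_one] with r hr
  have h := (hasSum_abelSum_monomial_zero i hΘ.1 hr.1 hr.2).sub hv
  have h3 := hasSum_norm_sq_of_hasSum (orthonormal_monomial_single i)
    (c := fun k => taylorCoeff Θ k * ((r : ℂ) ^ k - 1)) (h.congr_fun fun k => by
      rw [← sub_smul]; congr 1; ring)
  rw [h3.tsum_eq, Real.sqrt_sq (norm_nonneg _)]

theorem abelSum_mulCoord_comm {n : ℕ} (i j : Fin n) {Θ : ℂ → ℂ}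
    (hΘ : DifferentiableOn ℂ Θ (Metric.ball 0 1)) {r : ℝ} (h0 : 0 ≤ r) (h1 : r < 1)
    (x : HardySpace n) :
    abelSum (mulCoord i) Θ r (mulCoord j x) = mulCoord j (abelSum (mulCoord i) Θ r x) := by
  have h2 := (hasSum_abelSum_apply (norm_mulCoord_le i) hΘ h0 h1 x).mapL (mulCoord j)
  refine (hasSum_abelSum_apply (norm_mulCoord_le i) hΘ h0 h1 _).unique (h2.congr_fun fun k => ?_)
  have h3 : mulCoord i ^ k * mulCoord j = mulCoord j * mulCoord i ^ k :=
    (Commute.pow_left (mulCoord_mul_comm i j) k)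
  rw [map_smul, ← mul_apply_eq_comp, ← mul_apply_eq_comp, h3]

theorem induction_monomial {n : ℕ} {p : (Fin n → ℕ) → Prop} (h0 : p 0)
    (h : ∀ k i, p k → p (k + Pi.single i 1)) (k : Fin n → ℕ) : p k := by
  induction hm : ∑ i, k i generalizing k with
  | zero =>
    have : k = 0 := funext fun i => by simpa using (Finset.sum_eq_zero_iff.1 hm) i (Finset.mem_univ i)
    exact this ▸ h0
  | succ m ih =>
    obtain ⟨i, hi⟩ : ∃ i, k i ≠ 0 := by
      by_contra! hc
      simp [hc] at hm
    obtain ⟨l, rfl⟩ := exists_eq_add_single hi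
    refine h l i (ih l ?_)
    simpa [Finset.sum_add_distrib] using hm

/-! ### The H^∞ calculus of the compressions. -/

namespace QuotientModule

variable {n : ℕ} (Q : QuotientModule n)

theorem coe_abelSum_compression (i : Fin n) {Θ : ℂ → ℂ}
    (hΘ : DifferentiableOn ℂ Θ (Metric.ball 0 1)) {r : ℝ} (h0 : 0 ≤ r) (h1 : r < 1) (x : Q.space) :
    (abelSum (Q.compression i) Θ r x : HardySpace n) =
      Q.proj (abelSum (mulCoord i) Θ r (x : HardySpace n)) := by
  have h2 := (hasSum_abelSum_apply (Q.norm_compression_le i) hΘ h0 h1 x).mapL Q.space.subtypeL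
  have h3 := (hasSum_abelSum_apply (norm_mulCoord_le i) hΘ h0 h1 (x : HardySpace n)).mapL Q.proj
  refine h2.unique (h3.congr_fun fun k => ?_)
  rw [map_smul, map_smul, ← coe_compression_pow_apply]
  rfl

/-- The good x form a subspace. A monomial in it stays in it after multiplication by z_j, since
Θ(rM_i) commutes with M_j and P M_j = P M_j P; the uniform bound on Θ(rM_i) makes it closed. -/
theorem tendsto_proj_abelSum (i : Fin n) {Θ : ℂ → ℂ} (hΘ : IsHInf Θ)
    (h : Tendsto (fun r : ℝ => Q.proj (abelSum (mulCoord i) Θ r (monomial 0))) (𝓝[<] 1) (𝓝 0))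
    (x : HardySpace n) :
    Tendsto (fun r : ℝ => Q.proj (abelSum (mulCoord i) Θ r x)) (𝓝[<] 1) (𝓝 0) := by
  let Z : Submodule ℂ (HardySpace n) :=
    { carrier := {x | Tendsto (fun r : ℝ => Q.proj (abelSum (mulCoord i) Θ r x)) (𝓝[<] 1) (𝓝 0)}
      zero_mem' := by simp
      add_mem' := fun {x y} hx hy => by
        have : Tendsto _ (𝓝[<] (1 : ℝ)) (𝓝 ((0 : HardySpace n) + 0)) := Tendsto.add hx hy
        simpa using this
      smul_mem' := fun c x hx => by
        have : Tendsto _ (𝓝[<] (1 : ℝ)) (𝓝 (c • (0 : HardySpace n))) := Tendsto.const_smul hx c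
        simpa using this }
  have hmon : ∀ k, monomial k ∈ Z := by
    refine induction_monomial h fun k j hk => ?_
    change Tendsto _ _ _
    have h1 : Tendsto (fun r : ℝ => Q.proj (mulCoord j (Q.proj
        (abelSum (mulCoord i) Θ r (monomial k))))) (𝓝[<] 1) (𝓝 (Q.proj (mulCoord j 0))) :=
      ((Q.proj.continuous.comp (mulCoord j).continuous).tendsto 0).comp hk
    rw [map_zero, map_zero] at h1
    refine h1.congr' ?_
    filter_upwards [eventually_mem_Ico_zero_one] with r hr
    rw [proj_mulCoord_proj, ← abelSum_mulCoord_comm i j hΘ.1 hr.1 hr.2, mulCoord_monomial]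
  have hclosed : IsClosed (Z : Set (HardySpace n)) := by
    obtain ⟨hd, C, hC⟩ := hΘ
    have hC0 : 0 ≤ C := (norm_nonneg _).trans (hC 0 (by simp))
    rw [← closure_subset_iff_isClosed]
    intro y hy
    change Tendsto _ _ _
    rw [Metric.tendsto_nhds]
    intro ε hε
    -- Dividing by C + 1 rather than C keeps the radius meaningful when C = 0.
    obtain ⟨z, hz, hyz⟩ := Metric.mem_closure_iff.1 hy (ε / 2 / (C + 1)) (by positivity)
    have hz' : Tendsto _ _ _ := hz
    rw [Metric.tendsto_nhds] at hz'
    filter_upwards [hz' (ε / 2) (by positivity), eventually_mem_Ico_zero_one] with r h1 hr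
    rw [dist_zero_right] at h1 ⊢
    have h2 : ‖Q.proj (abelSum (mulCoord i) Θ r (y - z))‖ ≤ C * ‖y - z‖ :=
      (Q.space.norm_starProjection_apply_le _).trans ((le_opNorm _ _).trans
        (mul_le_mul_of_nonneg_right (norm_abelSum_mulCoord_le i hd hC hr.1 hr.2) (norm_nonneg _)))
    rw [dist_eq_norm, lt_div_iff₀ (by positivity)] at hyz
    have h3 : Q.proj (abelSum (mulCoord i) Θ r y) = Q.proj (abelSum (mulCoord i) Θ r z) +
        Q.proj (abelSum (mulCoord i) Θ r (y - z)) := by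
      rw [← map_add, ← map_add, add_sub_cancel]
    rw [h3]
    have := norm_nonneg (y - z)
    calc _ ≤ _ := norm_add_le _ _
      _ < ε / 2 + ε / 2 := by
        refine add_lt_add h1 (h2.trans_lt ?_)
        nlinarith
      _ = ε := add_halves ε
  have hx : x ∈ Z := mem_of_monomial_mem hclosed hmon ▸ Submodule.mem_top
  exact hx

/-- If `Θ(z_i)` is orthogonal to `Q`, then `Θ(C_{z_i}) = 0`. -/
theorem hasHInfValue_zero (i : Fin n) {Θ : ℂ → ℂ} (hΘ : IsHInf Θ) {v : HardySpace n}
    (hv : HasSum (fun k : ℕ => taylorCoeff Θ k • (monomial (Pi.single i k) : HardySpace n)) v)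
    (hvQ : v ∈ Q.spaceᗮ) : HasHInfValue (Q.compression i) Θ 0 := by
  intro x
  have h1 : Tendsto (fun r : ℝ => Q.proj (abelSum (mulCoord i) Θ r (monomial 0))) (𝓝[<] 1)
      (𝓝 (Q.proj v)) :=
    (Q.proj.continuous.tendsto v).comp (tendsto_abelSum_monomial_zero i hΘ hv)
  rw [(Submodule.starProjection_apply_eq_zero_iff _).2 hvQ] at h1
  have h2 := Q.tendsto_proj_abelSum i hΘ h1 x
  rw [IsInducing.subtypeVal.tendsto_nhds_iff]
  refine h2.congr' ?_
  filter_upwards [eventually_mem_Ico_zero_one] with r hr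
  exact (Q.coe_abelSum_compression i hΘ.1 hr.1 hr.2 x).symm

end QuotientModule

/-! ### Representing functions and tensor products of Jordan blocks. -/

theorem taylorCoeff_eq_zero {Θ : ℂ → ℂ} (h : ∀ z ∈ Metric.ball (0 : ℂ) 1, Θ z = 0) (k : ℕ) :
    taylorCoeff Θ k = 0 := by
  have : Θ =ᶠ[𝓝 0] fun _ => (0 : ℂ) := by
    filter_upwards [Metric.ball_mem_nhds (0 : ℂ) zero_lt_one] with z hz using h z hz
  rw [taylorCoeff, this.iteratedDeriv_eq k]
  simp

theorem hardyCoeff_hasSum_single {n : ℕ} {i : Fin n} {a : ℕ → ℂ} {v : HardySpace n}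
    (hv : HasSum (fun k : ℕ => a k • (monomial (Pi.single i k) : HardySpace n)) v) (k : ℕ) :
    hardyCoeff v (Pi.single i k) = a k :=
  inner_of_hasSum (orthonormal_monomial_single i) hv k

theorem single_zero_fin_one (m : ℕ) : (Pi.single (0 : Fin 1) m : Fin 1 → ℕ) = fun _ => m := by
  funext j
  rw [Subsingleton.elim j 0, Pi.single_eq_same]

theorem mem_innerMultiples {Θ : ℂ → ℂ} {g : HardySpace 1}
    (hg : HasSum (fun k : ℕ => taylorCoeff Θ k • (monomial (Pi.single 0 k) : HardySpace 1)) g) :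
    g ∈ innerMultiples Θ := by
  refine ⟨monomial 0, fun m => ?_⟩
  rw [← single_zero_fin_one, hardyCoeff_hasSum_single hg, Finset.sum_eq_single m]
  · rw [hardyCoeff_monomial, if_pos (by funext j; simp), mul_one]
  · intro j hj hjm
    rw [hardyCoeff_monomial, if_neg, mul_zero]
    intro h
    have := congrFun h 0
    simp only [Pi.zero_apply] at this
    have := Finset.mem_range.1 hj
    omega
  · intro h
    simp at h

theorem jordanBlock_eq_top {Θ : ℂ → ℂ} (h : ∀ z ∈ Metric.ball (0 : ℂ) 1, Θ z = 0) :
    jordanBlock Θ = ⊤ := by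
  have : Submodule.span ℂ (innerMultiples Θ) = ⊥ := by
    rw [Submodule.span_eq_bot]
    rintro g ⟨f, hf⟩
    refine hardyCoeff_ext fun k => ?_
    obtain ⟨m, rfl⟩ : ∃ m, k = fun _ => m :=
      ⟨k 0, funext fun j => by rw [Subsingleton.elim j 0]⟩
    rw [hf]
    simp [taylorCoeff_eq_zero h, hardyCoeff_eq_inner]
  rw [jordanBlock, this, Submodule.bot_orthogonal_eq_top]

theorem tensorJordanBlocks_eq_top {n : ℕ} {Θ : Fin n → ℂ → ℂ}
    (h : ∀ i, ∀ z ∈ Metric.ball (0 : ℂ) 1, Θ i z = 0) : tensorJordanBlocks Θ = ⊤ := by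
  refine mem_of_monomial_mem (Submodule.isClosed_topologicalClosure _) fun k => ?_
  refine Submodule.le_topologicalClosure _ (Submodule.subset_span ?_)
  refine ⟨fun i => monomial fun _ => k i, fun i => ?_, fun l => ?_⟩
  · rw [jordanBlock_eq_top (h i)]
    exact Submodule.mem_top
  · simp only [hardyCoeff_monomial, Finset.prod_ite_zero, Finset.prod_const_one]
    refine if_congr ?_ rfl rfl
    constructor
    · rintro rfl i _
      rfl
    · intro hl
      funext i
      exact congrFun (hl i (Finset.mem_univ i)) 0

/-- Pairing with Θ_i(z_i) sees only the coefficients of F = ∏ f_j(z_j) at powers of z_i. These are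
the coefficients of f_i times the constant ∏_{j ≠ i} f_j(0), so the pairing is a multiple of ⟨f_i,
Θ_i⟩ = 0. -/
theorem mem_orthogonal_tensorJordanBlocks {n : ℕ} {Θ : Fin n → ℂ → ℂ} (i : Fin n)
    (hΘ : IsHInf (Θ i)) {v : HardySpace n}
    (hv : HasSum (fun k : ℕ => taylorCoeff (Θ i) k • (monomial (Pi.single i k) : HardySpace n)) v) :
    v ∈ (tensorJordanBlocks Θ)ᗮ := by
  obtain ⟨g, hg⟩ := exists_hasSum_of_summable_norm_sq (orthonormal_monomial_single (0 : Fin 1))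
    (summable_norm_sq_taylorCoeff hΘ)
  rw [tensorJordanBlocks, Submodule.orthogonal_closure, Submodule.mem_orthogonal]
  intro F hF
  induction hF using Submodule.span_induction with
  | zero => simp
  | add x y _ _ hx hy => rw [inner_add_left, hx, hy, add_zero]
  | smul c x _ hx => rw [inner_smul_left, hx, mul_zero]
  | mem F hF =>
    obtain ⟨f, hf, hF⟩ := hF
    have h1 : inner ℂ (f i) g = 0 := by
      rw [← inner_conj_symm, (Submodule.mem_orthogonal _ _).1 (hf i) g
        (Submodule.subset_span (mem_innerMultiples hg)), map_zero]
    have h2 := hg.mapL (innerSL ℂ (f i))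
    have h3 := hv.mapL (innerSL ℂ F)
    simp only [innerSL_apply_apply, inner_smul_right] at h2 h3
    rw [h1] at h2
    have h4 := h2.mul_right (starRingEnd ℂ (∏ j ∈ Finset.univ.erase i, hardyCoeff (f j) 0))
    rw [zero_mul] at h4
    refine h3.unique (h4.congr_fun fun k => ?_)
    rw [← inner_conj_symm F, ← inner_conj_symm (f i), ← hardyCoeff_eq_inner, ← hardyCoeff_eq_inner,
      hF, mul_assoc, ← map_mul, ← Finset.mul_prod_erase _ _ (Finset.mem_univ i), Pi.single_eq_same,
      single_zero_fin_one]
    congr 3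
    refine Finset.prod_congr rfl fun j hj => ?_
    rw [Pi.single_eq_of_ne (Finset.ne_of_mem_erase hj)]
    rfl

theorem QuotientModule.isClassC0_compression {n : ℕ} (Q : QuotientModule n) {i : Fin n} {Θ : ℂ → ℂ}
    (h1 : IsHInf Θ) (h2 : NonzeroOnDisc Θ) (h3 : HasHInfValue (Q.compression i) Θ 0) :
    IsClassC0 (Q.compression i) :=
  ⟨Q.isCNUContraction_compression i, Θ, h1, h2, h3⟩

theorem QuotientModule.IsRepresentedBy.exists_hasHInfValue_zero {n : ℕ} {Q : QuotientModule n}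
    {Θ : Fin n → ℂ → ℂ} (h : Q.IsRepresentedBy Θ) (hQ : Q.space ≠ ⊤) :
    ∃ i, IsHInf (Θ i) ∧ NonzeroOnDisc (Θ i) ∧ HasHInfValue (Q.compression i) (Θ i) 0 := by
  obtain ⟨i, hi⟩ : ∃ i, NonzeroOnDisc (Θ i) := by
    by_contra! hc
    refine hQ (h.2.trans (tensorJordanBlocks_eq_top fun i z hz => ?_))
    by_contra hne
    exact hc i ⟨z, hz, hne⟩
  have hH : IsHInf (Θ i) := by
    refine (h.1 i).elim (fun h => h.1) fun h0 => ?_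
    obtain ⟨z, hz, hne⟩ := hi
    exact absurd (h0 z hz) hne
  obtain ⟨v, hv⟩ := exists_hasSum_of_summable_norm_sq (orthonormal_monomial_single i)
    (summable_norm_sq_taylorCoeff hH)
  exact ⟨i, hH, hi, Q.hasHInfValue_zero i hH hv (h.2 ▸ mem_orthogonal_tensorJordanBlocks i hH hv)⟩

/-! ### Wandering vectors -/

theorem hasFPowerSeriesOnBall_of_hasSum {a : ℕ → ℂ} {Θ : ℂ → ℂ}
    (h : ∀ z : ℂ, ‖z‖ < 1 → HasSum (fun k => a k * z ^ k) (Θ z)) :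
    HasFPowerSeriesOnBall Θ (FormalMultilinearSeries.ofScalars ℂ a) 0 1 where
  r_le := by
    refine ENNReal.le_of_forall_nnreal_lt fun r hr => ?_
    have hr1 : ‖((r : ℝ) : ℂ)‖ < 1 := by
      simpa using hr
    refine FormalMultilinearSeries.le_radius_of_summable_norm _ ?_
    refine (h _ hr1).summable.norm.congr fun k => ?_
    rw [FormalMultilinearSeries.ofScalars_norm, norm_mul, norm_pow]
    simp
  r_pos := zero_lt_one
  hasSum := by
    intro y hy
    rw [zero_add]
    refine (h y (by simpa [← ofReal_norm, ← ENNReal.ofReal_one] using hy)).congr_fun fun k => ?_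
    rw [FormalMultilinearSeries.ofScalars_apply_eq, smul_eq_mul]

theorem differentiableOn_of_hasSum {a : ℕ → ℂ} {Θ : ℂ → ℂ}
    (h : ∀ z : ℂ, ‖z‖ < 1 → HasSum (fun k => a k * z ^ k) (Θ z)) :
    DifferentiableOn ℂ Θ (Metric.ball 0 1) := by
  have := (hasFPowerSeriesOnBall_of_hasSum h).differentiableOn
  rwa [← ENNReal.ofReal_one, Metric.eball_ofReal] at this

theorem taylorCoeff_of_hasSum {a : ℕ → ℂ} {Θ : ℂ → ℂ}
    (h : ∀ z : ℂ, ‖z‖ < 1 → HasSum (fun k => a k * z ^ k) (Θ z)) (k : ℕ) :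
    taylorCoeff Θ k = a k := by
  have h1 := (hasFPowerSeriesOnBall_of_hasSum h).hasFPowerSeriesAt
  have h2 := h1.analyticAt.hasFPowerSeriesAt
  exact congrFun (FormalMultilinearSeries.ofScalars_series_injective ℂ ℂ
    (h2.eq_formalMultilinearSeries h1)) k

/-- If N ⊖ z_i N were zero, elements of N would be divisible by every power of z_i, and all their
coefficients would vanish. -/
theorem exists_wandering {n : ℕ} (i : Fin n) {N : Submodule ℂ (HardySpace n)}
    (hN : IsClosed (N : Set (HardySpace n))) (hinv : ∀ f ∈ N, mulCoord i f ∈ N) (hne : N ≠ ⊥) :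
    ∃ φ ∈ N, ‖φ‖ = 1 ∧ ∀ f ∈ N, inner ℂ (mulCoord i f) φ = 0 := by
  set K := N.map (mulCoord i : HardySpace n →ₗ[ℂ] HardySpace n) with hK
  have hKN : K ≤ N := by
    rintro _ ⟨f, hf, rfl⟩
    exact hinv f hf
  have hiso : Isometry (mulCoord (n := n) i) :=
    AddMonoidHomClass.isometry_of_norm _ (norm_mulCoord_apply i)
  have hKc : IsClosed (K : Set (HardySpace n)) := hiso.isClosedEmbedding.isClosedMap _ hN
  have : CompleteSpace K := hKc.completeSpace_coe
  obtain ⟨ψ, hψ, hψ0⟩ : ∃ ψ ∈ Kᗮ ⊓ N, ψ ≠ 0 := by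
    refine Submodule.exists_mem_ne_zero_of_ne_bot fun hbot => hne ?_
    have hKeq := Submodule.sup_orthogonal_inf_of_hasOrthogonalProjection hKN
    rw [hbot, sup_bot_eq] at hKeq
    have key : ∀ m : ℕ, ∀ f ∈ N, ∀ k : Fin n → ℕ, k i = m → hardyCoeff f k = 0 := by
      intro m
      induction m with
      | zero =>
        intro f hf k hk
        rw [← hKeq] at hf
        obtain ⟨g, -, rfl⟩ := hf
        exact hardyCoeff_mulCoord_of_eq_zero i _ hk
      | succ m ih =>
        intro f hf k hk
        obtain ⟨l, rfl⟩ : ∃ l, k = l + Pi.single i 1 := exists_eq_add_single (by omega)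
        rw [← hKeq] at hf
        obtain ⟨g, hg, rfl⟩ := hf
        rw [← hardyCoeff_adjoint_mulCoord]
        change hardyCoeff (adjoint (mulCoord i) (mulCoord i g)) l = 0
        rw [adjoint_mulCoord_mulCoord]
        exact ih g hg l (by simpa using hk)
    rw [eq_bot_iff]
    intro f hf
    refine hardyCoeff_ext fun k => ?_
    rw [key _ f hf k rfl]
    simp [hardyCoeff_eq_inner]
  refine ⟨(‖ψ‖⁻¹ : ℂ) • ψ, N.smul_mem _ hψ.2, ?_, fun f hf => ?_⟩
  · rw [norm_smul, norm_inv, Complex.norm_real, norm_norm,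
      inv_mul_cancel₀ (norm_ne_zero_iff.2 hψ0)]
  · rw [inner_smul_right]
    exact mul_eq_zero_of_right _ ((Submodule.mem_orthogonal _ _).1 hψ.1 _ ⟨f, hf, rfl⟩)

theorem orthonormal_pow_mulCoord {n : ℕ} (i : Fin n) {φ : HardySpace n} (hφ : ‖φ‖ = 1)
    (h : ∀ m : ℕ, inner ℂ ((mulCoord i ^ (m + 1)) φ) φ = 0) :
    Orthonormal ℂ fun m : ℕ => (mulCoord i ^ m) φ := by
  have hin : ∀ (m : ℕ) (f g : HardySpace n),
      inner ℂ ((mulCoord i ^ m) f) ((mulCoord i ^ m) g) = inner ℂ f g := by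
    intro m f g
    induction m with
    | zero => rfl
    | succ m ih =>
      rw [pow_succ', mul_apply_eq_comp, mul_apply_eq_comp, inner_mulCoord, ih]
  have hlt : ∀ a b : ℕ, b < a → inner ℂ ((mulCoord i ^ a) φ) ((mulCoord i ^ b) φ) = 0 := by
    intro a b hab
    obtain ⟨c, rfl⟩ : ∃ c, a = b + (c + 1) := ⟨a - b - 1, by omega⟩
    rw [pow_add, mul_apply_eq_comp, hin, h]
  refine ⟨fun m => ?_, fun a b hab => ?_⟩
  · rw [@norm_eq_sqrt_re_inner ℂ, hin, ← norm_eq_sqrt_re_inner, hφ]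
  · rcases lt_or_gt_of_ne hab with hab | hab
    · rw [← inner_conj_symm]
      exact (congrArg _ (hlt b a hab)).trans (map_zero _)
    · exact hlt a b hab

theorem adjoint_mulCoord_monomial_single_succ {n : ℕ} (i : Fin n) (k : ℕ) :
    adjoint (mulCoord i) (monomial (Pi.single i (k + 1))) = monomial (Pi.single i k) := by
  rw [Pi.single_add, ← mulCoord_monomial, adjoint_mulCoord_mulCoord]

/-- The Szegő kernel in the variable `z_i` is an eigenvector of `M_{z_i}^*`. -/
theorem exists_szegoKernel {n : ℕ} (i : Fin n) {w : ℂ} (hw : ‖w‖ < 1) :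
    ∃ κ : HardySpace n, HasSum (fun k : ℕ => (starRingEnd ℂ w) ^ k •
      (monomial (Pi.single i k) : HardySpace n)) κ ∧
      adjoint (mulCoord i) κ = starRingEnd ℂ w • κ := by
  obtain ⟨κ, hκ⟩ := exists_hasSum_of_summable_norm_sq (orthonormal_monomial_single i)
    (c := fun k => (starRingEnd ℂ w) ^ k) (by
      simp only [norm_pow, RCLike.norm_conj, ← pow_mul, mul_comm _ 2]
      simp only [pow_mul]
      exact summable_geometric_of_lt_one (by positivity) (pow_lt_one₀ (norm_nonneg _) hw two_ne_zero))
  refine ⟨κ, hκ, ?_⟩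
  have h1 := hκ.mapL (adjoint (mulCoord i))
  rw [← hasSum_nat_add_iff' 1] at h1
  simp only [map_smul, Finset.range_one, Finset.sum_singleton,
    adjoint_mulCoord_monomial_eq_zero (Pi.single_eq_same i 0), smul_zero, sub_zero,
    adjoint_mulCoord_monomial_single_succ] at h1
  refine h1.unique ((hκ.const_smul (starRingEnd ℂ w)).congr_fun fun k => ?_)
  rw [smul_smul, pow_succ']

/-- The eigenvector property gives |⟨M^m φ, κ⟩| = |w|^m |⟨φ, κ⟩|. Since ‖κ‖² = ∑ |w|^{2m}, Bessel's
inequality for the orbit of φ reads ‖κ‖² |⟨φ, κ⟩|² ≤ ‖κ‖². -/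
theorem norm_le_one_of_orthonormal {n : ℕ} (i : Fin n) {φ : HardySpace n}
    (h : Orthonormal ℂ fun m : ℕ => (mulCoord i ^ m) φ) {w : ℂ} {κ : HardySpace n}
    (hκ : HasSum (fun k : ℕ => (starRingEnd ℂ w) ^ k • (monomial (Pi.single i k) : HardySpace n)) κ)
    (hκ' : adjoint (mulCoord i) κ = starRingEnd ℂ w • κ) : ‖inner ℂ κ φ‖ ≤ 1 := by
  have h1 : ∀ m : ℕ, inner ℂ ((mulCoord i ^ m) φ) κ = (starRingEnd ℂ w) ^ m * inner ℂ φ κ := by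
    intro m
    induction m with
    | zero => simp
    | succ m ih =>
      rw [pow_succ', mul_apply_eq_comp, ← adjoint_inner_right, hκ', inner_smul_right, ih]
      ring
  have h2 := h.tsum_inner_products_le κ
  have h3 := hasSum_norm_sq_of_hasSum (orthonormal_monomial_single i) hκ
  simp only [h1, norm_mul, mul_pow] at h2
  rw [tsum_mul_right, h3.tsum_eq] at h2
  have h4 : κ ≠ 0 := by
    rintro rfl
    have := hardyCoeff_hasSum_single hκ 0
    simp [hardyCoeff_eq_inner] at this
  have h5 : 0 < ‖κ‖ ^ 2 := by positivity
  have h6 : ‖inner ℂ φ κ‖ ^ 2 ≤ 1 := by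
    by_contra hc
    push Not at hc
    nlinarith
  rw [norm_inner_symm]
  exact (sq_le_one_iff₀ (norm_nonneg _)).1 h6

/-- A form of Beurling's theorem: a nonzero closed `M_{z_i}`-invariant subspace of functions of
`z_i` contains a nonzero bounded function. -/
theorem exists_isHInf_of_invariant {n : ℕ} (i : Fin n) {N : Submodule ℂ (HardySpace n)}
    (hN : IsClosed (N : Set (HardySpace n))) (hinv : ∀ f ∈ N, mulCoord i f ∈ N) (hne : N ≠ ⊥)
    (hNi : ∀ f ∈ N, HasSum (fun k : ℕ => hardyCoeff f (Pi.single i k) •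
      (monomial (Pi.single i k) : HardySpace n)) f) :
    ∃ Θ : ℂ → ℂ, IsHInf Θ ∧ NonzeroOnDisc Θ ∧ ∃ v ∈ N,
      HasSum (fun k : ℕ => taylorCoeff Θ k • (monomial (Pi.single i k) : HardySpace n)) v := by
  obtain ⟨φ, hφN, hφ1, hφ⟩ := exists_wandering i hN hinv hne
  have hpow : ∀ m : ℕ, (mulCoord i ^ m) φ ∈ N := by
    intro m
    induction m with
    | zero => exact hφN
    | succ m ih =>
      rw [pow_succ', mul_apply_eq_comp]
      exact hinv _ ih
  have hon : Orthonormal ℂ fun m : ℕ => (mulCoord i ^ m) φ := by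
    refine orthonormal_pow_mulCoord i hφ1 fun m => ?_
    rw [pow_succ', mul_apply_eq_comp]
    exact hφ _ (hpow m)
  -- The value of φ at w is ⟨κ, φ⟩ for the Szegő kernel κ at w, so the power series of φ is bounded
  -- by 1 on the disc.
  have hker : ∀ w : ℂ, ‖w‖ < 1 → ∃ y : ℂ, ‖y‖ ≤ 1 ∧
      HasSum (fun k : ℕ => hardyCoeff φ (Pi.single i k) * w ^ k) y := by
    intro w hw
    obtain ⟨κ, hκ, hκ'⟩ := exists_szegoKernel i hw
    refine ⟨inner ℂ κ φ, norm_le_one_of_orthonormal i hon hκ hκ', ?_⟩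
    have h1 := (hNi φ hφN).mapL (innerSL ℂ κ)
    refine h1.congr_fun fun k => ?_
    rw [innerSL_apply_apply, inner_smul_right, ← inner_conj_symm κ, ← hardyCoeff_eq_inner,
      hardyCoeff_hasSum_single hκ, map_pow, Complex.conj_conj]
  set Θ : ℂ → ℂ := fun w => ∑' k : ℕ, hardyCoeff φ (Pi.single i k) * w ^ k with hΘ
  have hsum : ∀ w : ℂ, ‖w‖ < 1 →
      HasSum (fun k : ℕ => hardyCoeff φ (Pi.single i k) * w ^ k) (Θ w) := by
    intro w hw
    obtain ⟨y, -, hy⟩ := hker w hw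
    exact hy.summable.hasSum
  have hv : HasSum (fun k : ℕ => taylorCoeff Θ k • (monomial (Pi.single i k) : HardySpace n)) φ := by
    simpa only [taylorCoeff_of_hasSum hsum] using hNi φ hφN
  refine ⟨Θ, ⟨differentiableOn_of_hasSum hsum, 1, fun w hw => ?_⟩, ?_, φ, hφN, hv⟩
  · rw [mem_ball_zero_iff] at hw
    obtain ⟨y, hy1, hy⟩ := hker w hw
    rwa [(hsum w hw).unique hy]
  · by_contra hc
    have h0 : ∀ z ∈ Metric.ball (0 : ℂ) 1, Θ z = 0 := by
      intro z hz
      by_contra hne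
      exact hc ⟨z, hz, hne⟩
    simp only [taylorCoeff_eq_zero h0, zero_smul] at hv
    rw [hv.unique hasSum_zero, norm_zero] at hφ1
    exact zero_ne_one hφ1

/-! ### Functions independent of some of the variables -/

/-- The functions in `H²(𝔻ⁿ)` that do not depend on the variables `z_j`, `j ∈ s`. -/
def independent {n : ℕ} (s : Finset (Fin n)) : Submodule ℂ (HardySpace n) where
  carrier := {f | ∀ k : Fin n → ℕ, (∃ j ∈ s, k j ≠ 0) → hardyCoeff f k = 0}
  zero_mem' := fun k _ => by simp [hardyCoeff_eq_inner]
  add_mem' := fun {f g} hf hg k hk => by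
    rw [hardyCoeff_eq_inner, inner_add_right, ← hardyCoeff_eq_inner, ← hardyCoeff_eq_inner,
      hf k hk, hg k hk, add_zero]
  smul_mem' := fun c f hf k hk => by
    rw [hardyCoeff_eq_inner, inner_smul_right, ← hardyCoeff_eq_inner, hf k hk, mul_zero]

theorem isClosed_independent {n : ℕ} (s : Finset (Fin n)) :
    IsClosed (independent s : Set (HardySpace n)) := by
  have : (independent s : Set (HardySpace n)) =
      ⋂ (k : Fin n → ℕ) (_ : ∃ j ∈ s, k j ≠ 0), {f | hardyCoeff f k = 0} := by
    ext f
    simp only [Set.mem_iInter]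
    rfl
  rw [this]
  refine isClosed_iInter fun k => isClosed_iInter fun _ => ?_
  exact isClosed_eq (innerSL ℂ (monomial k)).continuous continuous_const

instance {n : ℕ} (s : Finset (Fin n)) : CompleteSpace (independent s) :=
  (isClosed_independent s).completeSpace_coe

/-- The orthogonal projection onto the functions independent of the variables `z_j`, `j ∈ s`. -/
abbrev independentProj {n : ℕ} (s : Finset (Fin n)) : HardySpace n →L[ℂ] HardySpace n :=
  (independent s).starProjection

theorem monomial_mem_independent {n : ℕ} {s : Finset (Fin n)} {k : Fin n → ℕ}
    (h : ∀ j ∈ s, k j = 0) : monomial k ∈ independent s := by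
  rintro l ⟨j, hj, hlj⟩
  rw [hardyCoeff_monomial, if_neg]
  rintro rfl
  exact hlj (h j hj)

theorem independentProj_monomial {n : ℕ} {s : Finset (Fin n)} {k : Fin n → ℕ}
    (h : ∀ j ∈ s, k j = 0) : independentProj s (monomial k) = monomial k :=
  Submodule.starProjection_eq_self_iff.2 (monomial_mem_independent h)

theorem independentProj_monomial_eq_zero {n : ℕ} {s : Finset (Fin n)} {k : Fin n → ℕ}
    (h : ∃ j ∈ s, k j ≠ 0) : independentProj s (monomial k) = 0 := by
  rw [Submodule.starProjection_apply_eq_zero_iff, Submodule.mem_orthogonal]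
  intro f hf
  rw [← inner_conj_symm, ← hardyCoeff_eq_inner, hf k h, map_zero]

theorem independentProj_empty {n : ℕ} : independentProj (∅ : Finset (Fin n)) = 1 :=
  clm_ext_monomial fun _ => independentProj_monomial (by simp)

/-- Being independent of z_a is the range condition for 1 - M_a M_a^*, and the projection for s
commutes with M_a. The sandwiched form is the one that survives compression to Q. -/
theorem independentProj_insert {n : ℕ} {s : Finset (Fin n)} {a : Fin n} (ha : a ∉ s) :
    independentProj (insert a s) = independentProj s -
      mulCoord a * independentProj s * adjoint (mulCoord a) := by
  refine clm_ext_monomial fun k => ?_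
  change _ = independentProj s (monomial k) -
    mulCoord a (independentProj s (adjoint (mulCoord a) (monomial k)))
  by_cases hk : k a = 0
  · rw [adjoint_mulCoord_monomial_eq_zero hk, map_zero, map_zero, sub_zero]
    by_cases h : ∀ j ∈ s, k j = 0
    · rw [independentProj_monomial h, independentProj_monomial]
      intro j hj
      rcases Finset.mem_insert.1 hj with rfl | hj
      · exact hk
      · exact h j hj
    · push Not at h
      rw [independentProj_monomial_eq_zero h, independentProj_monomial_eq_zero]
      obtain ⟨j, hj, hkj⟩ := h
      exact ⟨j, Finset.mem_insert_of_mem hj, hkj⟩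
  · rw [independentProj_monomial_eq_zero ⟨a, Finset.mem_insert_self a s, hk⟩]
    obtain ⟨l, rfl⟩ := exists_eq_add_single hk
    have hl : ∀ j ∈ s, (l + (Pi.single a 1 : Fin n → ℕ)) j = l j := by
      intro j hj
      have : j ≠ a := fun h => ha (h ▸ hj)
      simp [this]
    rw [← mulCoord_monomial, adjoint_mulCoord_mulCoord, mulCoord_monomial]
    by_cases h : ∀ j ∈ s, l j = 0
    · rw [independentProj_monomial h, mulCoord_monomial, independentProj_monomial, sub_self]
      intro j hj
      rw [hl j hj, h j hj]
    · push Not at h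
      rw [independentProj_monomial_eq_zero h, independentProj_monomial_eq_zero, map_zero, sub_zero]
      obtain ⟨j, hj, hkj⟩ := h
      exact ⟨j, hj, by rwa [hl j hj]⟩

theorem independentProj_univ_apply {n : ℕ} (f : HardySpace n) :
    independentProj (Finset.univ : Finset (Fin n)) f = hardyCoeff f 0 • monomial 0 := by
  refine hardyCoeff_ext fun k => ?_
  rw [hardyCoeff_eq_inner, hardyCoeff_eq_inner, inner_smul_right,
    ← Submodule.inner_starProjection_left_eq_right]
  by_cases hk : k = 0
  · subst hk
    change inner ℂ (independentProj _ _) _ = _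
    rw [independentProj_monomial (by simp), ← hardyCoeff_eq_inner, ← hardyCoeff_eq_inner,
      hardyCoeff_monomial, if_pos rfl, mul_one]
  · change inner ℂ (independentProj _ _) _ = _
    rw [independentProj_monomial_eq_zero, inner_zero_left, ← hardyCoeff_eq_inner,
      hardyCoeff_monomial, if_neg hk, mul_zero]
    obtain ⟨j, hj⟩ := Function.ne_iff.1 hk
    exact ⟨j, Finset.mem_univ j, hj⟩

theorem eq_single_of_erase {n : ℕ} {i : Fin n} {k : Fin n → ℕ}
    (h : ∀ j ∈ Finset.univ.erase i, k j = 0) : k = Pi.single i (k i) := by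
  funext j
  by_cases hj : j = i
  · subst hj; simp
  · rw [Pi.single_eq_of_ne hj, h j (by simp [hj])]

theorem single_mem_independent {n : ℕ} (i : Fin n) (m : ℕ) :
    monomial (Pi.single i m) ∈ independent (Finset.univ.erase i) :=
  monomial_mem_independent fun _ hj => by
    rw [Pi.single_eq_of_ne (Finset.ne_of_mem_erase hj)]

theorem hasSum_of_mem_independent {n : ℕ} {i : Fin n} {f : HardySpace n}
    (hf : f ∈ independent (Finset.univ.erase i)) :
    HasSum (fun k : ℕ => hardyCoeff f (Pi.single i k) •
      (monomial (Pi.single i k) : HardySpace n)) f := by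
  have h := (monomialBasis n).hasSum_repr f
  simp only [monomialBasis_repr, coe_monomialBasis] at h
  rwa [← Function.Injective.hasSum_iff (Pi.single_injective i)] at h
  intro k hk
  rw [hf k, zero_smul]
  by_contra! hc
  exact hk ⟨k i, (eq_single_of_erase hc).symm⟩

theorem mulCoord_mem_independent {n : ℕ} {s : Finset (Fin n)} {i : Fin n} (hi : i ∉ s)
    {f : HardySpace n} (hf : f ∈ independent s) : mulCoord i f ∈ independent s := by
  rintro k ⟨j, hj, hkj⟩
  by_cases hk : k i = 0
  · exact hardyCoeff_mulCoord_of_eq_zero i f hk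
  · obtain ⟨l, rfl⟩ := exists_eq_add_single hk
    rw [← hardyCoeff_adjoint_mulCoord, adjoint_mulCoord_mulCoord]
    refine hf l ⟨j, hj, ?_⟩
    have : j ≠ i := fun h => hi (h ▸ hj)
    simpa [this] using hkj

/-! ### Doubly commuting quotient modules -/

namespace QuotientModule

variable {n : ℕ} {Q : QuotientModule n}

theorem proj_mul_proj (Q : QuotientModule n) : Q.proj * Q.proj = Q.proj :=
  Submodule.isIdempotentElem_starProjection _

theorem proj_mul_mulCoord_mul_proj (Q : QuotientModule n) (i : Fin n) :
    Q.proj * mulCoord i * Q.proj = Q.proj * mulCoord i :=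
  ContinuousLinearMap.ext fun f => Q.proj_mulCoord_proj i f

theorem star_starProjection (K : Submodule ℂ (HardySpace n)) [K.HasOrthogonalProjection] :
    star K.starProjection = K.starProjection :=
  isSelfAdjoint_starProjection K

theorem proj_mul_star_mulCoord_mul_proj (Q : QuotientModule n) (i : Fin n) :
    Q.proj * star (mulCoord i) * Q.proj = star (mulCoord i) * Q.proj := by
  have h := congrArg star (Q.proj_mul_mulCoord_mul_proj i)
  simpa only [star_mul, star_starProjection, mul_assoc] using h

theorem proj_mulCoord_adjoint_apply (h : Q.DoublyCommuting) {i j : Fin n} (hij : i ≠ j)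
    {f : HardySpace n} (hf : f ∈ Q.space) :
    Q.proj (mulCoord i (adjoint (mulCoord j) f)) = adjoint (mulCoord j) (Q.proj (mulCoord i f)) := by
  have hC : Q.compression i ∘L adjoint (Q.compression j) =
      adjoint (Q.compression j) ∘L Q.compression i := by
    rcases lt_or_gt_of_ne hij with hij | hij
    · exact h i j hij
    -- Double commutation is assumed only for ordered pairs; the other order is the adjoint
    -- relation.
    · have h2 := congrArg adjoint (h j i hij)
      simpa only [adjoint_comp, adjoint_adjoint] using h2
  have h2 := congrArg (fun A : Q.space →L[ℂ] Q.space => ((A ⟨f, hf⟩ : Q.space) : HardySpace n)) hC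
  simp only [comp_apply, coe_compression_apply, coe_adjoint_compression_apply] at h2
  exact h2

/-- The module operator `C_{z_i}`, extended by zero to the orthogonal complement of `Q`. -/
def extendedCompression (Q : QuotientModule n) (i : Fin n) : HardySpace n →L[ℂ] HardySpace n :=
  Q.proj * mulCoord i

theorem star_extendedCompression (Q : QuotientModule n) (i : Fin n) :
    star (Q.extendedCompression i) = star (mulCoord i) * Q.proj := by
  rw [extendedCompression, star_mul, star_starProjection]

theorem commute_extendedCompression (Q : QuotientModule n) (i j : Fin n) :
    Commute (Q.extendedCompression i) (Q.extendedCompression j) := by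
  change Q.proj * mulCoord i * (Q.proj * mulCoord j) = Q.proj * mulCoord j * (Q.proj * mulCoord i)
  rw [← mul_assoc, ← mul_assoc, proj_mul_mulCoord_mul_proj, proj_mul_mulCoord_mul_proj, mul_assoc,
    mul_assoc, mulCoord_mul_comm]

theorem commute_extendedCompression_star (h : Q.DoublyCommuting) {i j : Fin n} (hij : i ≠ j) :
    Commute (Q.extendedCompression i) (star (Q.extendedCompression j)) := by
  rw [star_extendedCompression]
  refine ContinuousLinearMap.ext fun f => ?_
  change Q.proj (mulCoord i (adjoint (mulCoord j) (Q.proj f))) =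
    adjoint (mulCoord j) (Q.proj (Q.proj (mulCoord i f)))
  have h1 : Q.proj (Q.proj (mulCoord i f)) = Q.proj (mulCoord i f) :=
    congrArg (fun A : HardySpace n →L[ℂ] HardySpace n => A (mulCoord i f)) Q.proj_mul_proj
  rw [proj_mulCoord_adjoint_apply h hij (Submodule.starProjection_apply_mem _ _),
    proj_mulCoord_proj, h1]

/-- The compression to `Q` of the projection onto the functions independent of `z_j`, `j ∈ s`. -/
def defect (Q : QuotientModule n) (s : Finset (Fin n)) : HardySpace n →L[ℂ] HardySpace n :=
  Q.proj * independentProj s * Q.proj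

theorem star_defect (Q : QuotientModule n) (s : Finset (Fin n)) :
    star (Q.defect s) = Q.defect s := by
  simp only [defect, star_mul, star_starProjection, mul_assoc]

/-- Since P M_a = P M_a P, and dually for the adjoint, the recursion for the projections compresses
term by term. -/
theorem defect_insert (Q : QuotientModule n) {s : Finset (Fin n)} {a : Fin n} (ha : a ∉ s) :
    Q.defect (insert a s) = Q.defect s -
      Q.extendedCompression a * Q.defect s * star (Q.extendedCompression a) := by
  have h1 : Q.extendedCompression a * Q.defect s * star (Q.extendedCompression a) =
      (Q.proj * mulCoord a * Q.proj) * independentProj s *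
        (Q.proj * star (mulCoord a) * Q.proj) := by
    rw [star_extendedCompression, extendedCompression, defect]
    rw [show Q.proj * mulCoord a * (Q.proj * independentProj s * Q.proj) *
      (star (mulCoord a) * Q.proj) = Q.proj * mulCoord a * Q.proj * independentProj s *
        (Q.proj * star (mulCoord a) * Q.proj) by simp only [mul_assoc]]
  rw [h1, proj_mul_mulCoord_mul_proj, proj_mul_star_mulCoord_mul_proj, defect, defect,
    independentProj_insert ha, ← star_eq_adjoint]
  simp only [mul_sub, sub_mul, mul_assoc]

/-- By the recursion, the defect is built from P and from C_b, C_b^* with b ∈ s, all of which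
commute with C_a for a ∉ s. -/
theorem commute_defect_extendedCompression (h : Q.DoublyCommuting) (s : Finset (Fin n)) :
    ∀ a ∉ s, Commute (Q.defect s) (Q.extendedCompression a) := by
  induction s using Finset.induction_on with
  | empty =>
    intro a _
    rw [defect, independentProj_empty, mul_one, proj_mul_proj]
    change Q.proj * (Q.proj * mulCoord a) = Q.proj * mulCoord a * Q.proj
    rw [proj_mul_mulCoord_mul_proj, ← mul_assoc, proj_mul_proj]
  | insert b s hb ih =>
    intro a ha
    rw [Finset.mem_insert, not_or] at ha
    rw [defect_insert Q hb]
    refine (ih a ha.2).sub_left (((Q.commute_extendedCompression b a).mul_left (ih a ha.2)).mul_left ?_)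
    exact (commute_extendedCompression_star h ha.1).symm

theorem defect_univ (h : Q.DoublyCommuting) (i : Fin n) :
    Q.defect Finset.univ = Q.defect (Finset.univ.erase i) -
      Q.extendedCompression i * star (Q.extendedCompression i) *
        Q.defect (Finset.univ.erase i) := by
  have hi : i ∉ Finset.univ.erase i := Finset.notMem_erase i _
  have h1 := congrArg star (commute_defect_extendedCompression h _ i hi).eq
  rw [star_mul, star_mul, star_defect] at h1
  have h2 := defect_insert Q hi
  rw [Finset.insert_erase (Finset.mem_univ i)] at h2
  rw [h2, mul_assoc, mul_assoc, h1]

/-- If P1 = 0, all elements of Q have zero constant term; backward shifts, which preserve Q, carry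
every coefficient to the constant one. -/
theorem proj_monomial_zero_ne_zero (hQ : Q.space ≠ ⊥) : Q.proj (monomial 0) ≠ 0 := by
  intro h0
  refine hQ ((Submodule.eq_bot_iff _).2 fun f hf => hardyCoeff_ext fun k => ?_)
  have hcoef : hardyCoeff (0 : HardySpace n) k = 0 := by simp [hardyCoeff_eq_inner]
  rw [hcoef]
  revert f
  refine induction_monomial (p := fun k => ∀ f ∈ Q.space, hardyCoeff f k = 0) ?_ ?_ k
  · intro f hf
    rw [Submodule.starProjection_apply_eq_zero_iff, Submodule.mem_orthogonal] at h0
    rw [hardyCoeff_eq_inner, ← inner_conj_symm, h0 f hf, map_zero]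
  · intro k i hk f hf
    rw [← hardyCoeff_adjoint_mulCoord]
    exact hk _ (Q.adjoint_mem i f hf)

/-! ### The case where no nonzero function of z_i alone is orthogonal to Q. -/

section NoFunctionOfOneVariable

variable {i : Fin n}

/-- The difference of the two sides is a function of z_i alone. Its projection to Q is the
commutator of C_{z_i} with the defect, which is zero, so `hi` kills it. -/
theorem mulCoord_independentProj_proj (h : Q.DoublyCommuting)
    (hi : ∀ f ∈ independent (Finset.univ.erase i), f ∈ Q.spaceᗮ → f = 0) (f : HardySpace n) :
    mulCoord i (independentProj (Finset.univ.erase i) (Q.proj f)) =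
      independentProj (Finset.univ.erase i) (Q.proj (mulCoord i f)) := by
  set E := independentProj (Finset.univ.erase i) with hE
  have hie : i ∉ Finset.univ.erase i := Finset.notMem_erase i _
  refine sub_eq_zero.1 (hi _ (Submodule.sub_mem _ (mulCoord_mem_independent hie
    (Submodule.starProjection_apply_mem _ _)) (Submodule.starProjection_apply_mem _ _)) ?_)
  rw [← Submodule.starProjection_apply_eq_zero_iff, map_sub, sub_eq_zero]
  have h1 := congrArg (fun A : HardySpace n →L[ℂ] HardySpace n => A f)
    (commute_defect_extendedCompression h _ i hie).eq
  have h2 : Q.proj (E (Q.proj (Q.proj (mulCoord i f)))) =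
    Q.proj (mulCoord i (Q.proj (E (Q.proj f)))) := h1
  rw [proj_mulCoord_proj] at h2
  rw [← h2, Submodule.starProjection_eq_self_iff.2 (Submodule.starProjection_apply_mem _ _)]

/-- By self-adjointness the coefficient of E P 1 at z_i^{m+1} is conjugate to the constant term of E
P z_i^{m+1} = z_i E P z_i^m, which is zero. -/
theorem independentProj_proj_monomial_zero (h : Q.DoublyCommuting)
    (hi : ∀ f ∈ independent (Finset.univ.erase i), f ∈ Q.spaceᗮ → f = 0) :
    independentProj (Finset.univ.erase i) (Q.proj (monomial 0)) =
      hardyCoeff (Q.proj (monomial 0)) 0 • monomial 0 := by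
  refine hardyCoeff_ext fun k => ?_
  have hr : ∀ c : ℂ, hardyCoeff (c • monomial 0 : HardySpace n) k = if k = 0 then c else 0 := by
    intro c
    rw [hardyCoeff_eq_inner, inner_smul_right, ← hardyCoeff_eq_inner, hardyCoeff_monomial,
      mul_ite, mul_one, mul_zero]
  rw [hr]
  have hE0 : independentProj (Finset.univ.erase i) (monomial 0 : HardySpace n) = monomial 0 :=
    independentProj_monomial (by simp)
  by_cases hk : ∀ j ∈ Finset.univ.erase i, k j = 0
  · rw [eq_single_of_erase hk]
    rcases hm : k i with _ | m
    · rw [Pi.single_zero, if_pos rfl, hardyCoeff_eq_inner,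
        ← Submodule.inner_starProjection_left_eq_right]
      exact congrArg (inner ℂ · _) hE0
    · have hm0 : (Pi.single i (m + 1) : Fin n → ℕ) ≠ 0 := by
        rw [Ne, Pi.single_eq_zero_iff]
        omega
      have hinn : ∀ f g : HardySpace n, inner ℂ f (independentProj (Finset.univ.erase i) (Q.proj g)) =
          inner ℂ (Q.proj (independentProj (Finset.univ.erase i) f)) g := by
        intro f g
        rw [← Submodule.inner_starProjection_left_eq_right,
          ← Submodule.inner_starProjection_left_eq_right]
      have hm1 : independentProj (Finset.univ.erase i)
          (monomial (Pi.single i (m + 1)) : HardySpace n) = monomial (Pi.single i (m + 1)) :=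
        Submodule.starProjection_eq_self_iff.2 (single_mem_independent i _)
      have hz : inner ℂ (monomial 0 : HardySpace n) (independentProj (Finset.univ.erase i)
          (Q.proj (monomial (Pi.single i (m + 1))))) = 0 := by
        rw [Pi.single_add, ← mulCoord_monomial, ← mulCoord_independentProj_proj h hi]
        exact hardyCoeff_mulCoord_of_eq_zero i _ rfl
      rw [if_neg hm0, hardyCoeff_eq_inner, hinn, hm1, ← inner_conj_symm, ← hE0,
        Submodule.inner_starProjection_left_eq_right, hz, map_zero]
  · push Not at hk
    have hk0 : k ≠ 0 := by
      rintro rfl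
      simp at hk
    rw [if_neg hk0]
    exact Submodule.starProjection_apply_mem (independent (Finset.univ.erase i)) _ k hk

theorem independentProj_proj_monomial_single (h : Q.DoublyCommuting)
    (hi : ∀ f ∈ independent (Finset.univ.erase i), f ∈ Q.spaceᗮ → f = 0) (m : ℕ) :
    independentProj (Finset.univ.erase i) (Q.proj (monomial (Pi.single i m))) =
      hardyCoeff (Q.proj (monomial 0)) 0 • monomial (Pi.single i m) := by
  induction m with
  | zero =>
    rw [Pi.single_zero]
    exact independentProj_proj_monomial_zero h hi
  | succ m ih =>
    rw [Pi.single_add, ← mulCoord_monomial, ← mulCoord_independentProj_proj h hi, ih, map_smul]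

theorem hardyCoeff_proj_monomial_zero_ne_zero (hQ : Q.space ≠ ⊥) :
    hardyCoeff (Q.proj (monomial 0)) 0 ≠ 0 := by
  intro h0
  have h1 : inner ℂ (Q.proj (monomial 0)) (Q.proj (monomial 0)) = (0 : ℂ) := by
    rw [Submodule.inner_starProjection_left_eq_right,
      Submodule.starProjection_eq_self_iff.2 (Submodule.starProjection_apply_mem _ _)]
    exact h0
  exact proj_monomial_zero_ne_zero hQ (inner_self_eq_zero.1 h1)

/-- The defects for all variables and for all but z_i both send 1 to c P1. Their difference is
C_{z_i} C_{z_i}^* times the latter, and c ≠ 0, so C_{z_i}^* P1 = 0. -/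
theorem adjoint_mulCoord_proj_monomial_zero (h : Q.DoublyCommuting) (hQ : Q.space ≠ ⊥)
    (hi : ∀ f ∈ independent (Finset.univ.erase i), f ∈ Q.spaceᗮ → f = 0) :
    adjoint (mulCoord i) (Q.proj (monomial 0)) = 0 := by
  have hc := hardyCoeff_proj_monomial_zero_ne_zero hQ
  set c := hardyCoeff (Q.proj (monomial 0)) 0 with hcdef
  set g := Q.proj (monomial 0) with hg
  have hPg : Q.proj g = g :=
    Submodule.starProjection_eq_self_iff.2 (Submodule.starProjection_apply_mem _ _)
  have h1 : Q.defect Finset.univ (monomial 0) = c • g := by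
    change Q.proj (independentProj Finset.univ (Q.proj (monomial 0))) = _
    rw [independentProj_univ_apply, map_smul]
  have h2 : Q.defect (Finset.univ.erase i) (monomial 0) = c • g := by
    change Q.proj (independentProj (Finset.univ.erase i) (Q.proj (monomial 0))) = _
    rw [independentProj_proj_monomial_zero h hi, map_smul]
  have h3 := congrArg (fun A : HardySpace n →L[ℂ] HardySpace n => A (monomial 0)) (defect_univ h i)
  have h4 : Q.defect Finset.univ (monomial 0) = Q.defect (Finset.univ.erase i) (monomial 0) -
      Q.extendedCompression i (star (Q.extendedCompression i)
        (Q.defect (Finset.univ.erase i) (monomial 0))) := h3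
  rw [h1, h2, eq_comm, sub_eq_self, map_smul, map_smul, smul_eq_zero] at h4
  have h5 := h4.resolve_left hc
  have h6 : inner ℂ (star (Q.extendedCompression i) g) (star (Q.extendedCompression i) g) =
      (0 : ℂ) := by
    rw [star_eq_adjoint, adjoint_inner_left, ← star_eq_adjoint, h5, inner_zero_right]
  have h7 := inner_self_eq_zero.1 h6
  rw [star_extendedCompression] at h7
  change adjoint (mulCoord i) (Q.proj g) = 0 at h7
  rwa [hPg] at h7

end NoFunctionOfOneVariable

/-! ### Recovering all monomials, and the dichotomy. -/

theorem mem_of_norm_le_norm_proj {f : HardySpace n} (h : ‖f‖ ≤ ‖Q.proj f‖) : f ∈ Q.space := by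
  rw [Submodule.mem_iff_norm_starProjection]
  exact le_antisymm (Q.space.norm_starProjection_apply_le _) h

/-- Double commutation applied to z_i z^l ∈ Q gives z_j z^l = M_i^* P(z_i z_j z^l). The left side
has norm 1, so P loses no norm on z_i z_j z^l. -/
theorem monomial_add_single_mem (h : Q.DoublyCommuting) {i j : Fin n} (hij : i ≠ j)
    {l : Fin n → ℕ} (hi : monomial (l + Pi.single i 1) ∈ Q.space)
    (hj : monomial (l + Pi.single j 1) ∈ Q.space) :
    monomial (l + Pi.single j 1 + Pi.single i 1) ∈ Q.space := by
  set k := l + Pi.single j 1 + Pi.single i 1 with hk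
  have h1 : Q.proj (mulCoord j (adjoint (mulCoord i) (monomial (l + Pi.single i 1)))) =
      adjoint (mulCoord i) (Q.proj (mulCoord j (monomial (l + Pi.single i 1)))) :=
    proj_mulCoord_adjoint_apply h hij.symm hi
  rw [← mulCoord_monomial, adjoint_mulCoord_mulCoord, mulCoord_monomial, mulCoord_monomial,
    mulCoord_monomial, add_right_comm, Submodule.starProjection_eq_self_iff.2 hj, ← hk] at h1
  refine mem_of_norm_le_norm_proj ?_
  rw [norm_monomial, ← norm_monomial (l + Pi.single j 1), h1]
  refine (le_opNorm _ _).trans ?_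
  rw [LinearIsometryEquiv.norm_map]
  exact mul_le_of_le_one_left (norm_nonneg _) (norm_mulCoord_le i)

theorem space_eq_top (h : Q.DoublyCommuting) (hQ : Q.space ≠ ⊥)
    (hi : ∀ i, ∀ f ∈ independent (Finset.univ.erase i), f ∈ Q.spaceᗮ → f = 0) :
    Q.space = ⊤ := by
  have hc := hardyCoeff_proj_monomial_zero_ne_zero hQ
  have hg : Q.proj (monomial 0) = hardyCoeff (Q.proj (monomial 0)) 0 • monomial 0 := by
    refine hardyCoeff_ext fun k => ?_
    rw [hardyCoeff_eq_inner (_ • _), inner_smul_right, ← hardyCoeff_eq_inner, hardyCoeff_monomial]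
    by_cases hk : k = 0
    · simp [hk]
    · obtain ⟨i, hki⟩ := Function.ne_iff.1 hk
      obtain ⟨l, rfl⟩ := exists_eq_add_single hki
      rw [if_neg hk, mul_zero, ← hardyCoeff_adjoint_mulCoord,
        adjoint_mulCoord_proj_monomial_zero h hQ (hi i)]
      simp [hardyCoeff_eq_inner]
  have h0 : monomial 0 ∈ Q.space := by
    rw [← Submodule.smul_mem_iff _ hc, ← hg]
    exact Submodule.starProjection_apply_mem _ _
  have hc1 : hardyCoeff (Q.proj (monomial 0)) 0 = 1 := by
    rw [Submodule.starProjection_eq_self_iff.2 h0, hardyCoeff_monomial, if_pos rfl]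
  have hsingle : ∀ i m, monomial (Pi.single i m) ∈ Q.space := by
    intro i m
    have h1 := independentProj_proj_monomial_single h (hi i) m
    rw [hc1, one_smul] at h1
    refine mem_of_norm_le_norm_proj ?_
    conv_lhs => rw [← h1]
    exact Submodule.norm_starProjection_apply_le _ _
  refine mem_of_monomial_mem Q.isClosed fun k => ?_
  -- A monomial involving two variables z_i, z_j is z_i z_j z^l, and both z_i z^l and z_j z^l have
  -- degree one less.
  induction hN : ∑ i, k i using Nat.strong_induction_on generalizing k with
  | _ N ih =>
    by_cases hk : k = 0
    · exact hk ▸ h0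
    obtain ⟨i, hki⟩ := Function.ne_iff.1 hk
    obtain ⟨l, rfl⟩ := exists_eq_add_single hki
    by_cases hl : ∀ j ∈ Finset.univ.erase i, l j = 0
    · rw [eq_single_of_erase hl, ← Pi.single_add]
      exact hsingle i _
    · push Not at hl
      obtain ⟨j, hj, hlj⟩ := hl
      obtain ⟨l, rfl⟩ := exists_eq_add_single hlj
      simp only [Pi.add_apply, Finset.sum_add_distrib, Finset.sum_pi_single', Finset.mem_univ,
        if_true] at hN
      refine monomial_add_single_mem h (Finset.ne_of_mem_erase hj).symm
        (ih (∑ a, l a + 1) (by omega) _ ?_) (ih (∑ a, l a + 1) (by omega) _ ?_) <;>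
      simp [Finset.sum_add_distrib]

theorem exists_isClassC0_compression (h : Q.DoublyCommuting) (hnt : Q.Nontrivial) :
    ∃ i, IsClassC0 (Q.compression i) := by
  -- Properness of Q rules out the case in which no Qᗮ-function of a single variable exists.
  obtain ⟨i, f, hf, hfQ, hf0⟩ : ∃ i, ∃ f ∈ independent (Finset.univ.erase i),
      f ∈ Q.spaceᗮ ∧ f ≠ 0 := by
    by_contra! hc
    exact hnt.2 (space_eq_top h hnt.1 hc)
  have hie : i ∉ Finset.univ.erase i := Finset.notMem_erase i _
  obtain ⟨Θ, h1, h2, v, hv, hsum⟩ := exists_isHInf_of_invariant i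
    (N := independent (Finset.univ.erase i) ⊓ Q.spaceᗮ)
    ((isClosed_independent _).inter (Submodule.isClosed_orthogonal _))
    (fun g hg => ⟨mulCoord_mem_independent hie hg.1, Q.mulCoord_mem_orthogonal i hg.2⟩)
    (fun hbot => hf0 ((Submodule.mem_bot ℂ).1 (hbot ▸ ⟨hf, hfQ⟩)))
    (fun g hg => hasSum_of_mem_independent hg.1)
  exact ⟨i, Q.isClassC0_compression h1 h2 (Q.hasHInfValue_zero i h1 hsum hv.2)⟩

end QuotientModule
end HardyPolydisc

end

theorem mainTheorem11 (n : ℕ) (hn : 2 ≤ n) (Q : HardyPolydisc.QuotientModule n)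
    (hdc : Q.DoublyCommuting) (hnt : Q.Nontrivial) :
    (∃ i : Fin n, HardyPolydisc.IsClassC0 (Q.compression i)) ∧
    (∀ Θ : Fin n → ℂ → ℂ, Q.IsRepresentedBy Θ →
      ∃ i : Fin n, HardyPolydisc.IsClassC0 (Q.compression i) ∧
        HardyPolydisc.IsHInf (Θ i) ∧ HardyPolydisc.NonzeroOnDisc (Θ i) ∧
        HardyPolydisc.HasHInfValue (Q.compression i) (Θ i) 0) := by
  refine ⟨HardyPolydisc.QuotientModule.exists_isClassC0_compression hdc hnt, fun Θ hΘ => ?_⟩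
  obtain ⟨i, h1, h2, h3⟩ := hΘ.exists_hasHInfValue_zero hnt.2
  exact ⟨i, Q.isClassC0_compression h1 h2 h3, h1, h2, h3⟩
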